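/- Consider the planar piecewise linear differential system with switching line $\Sigma=\{x=0\}$, $$\begin{cases}\dot x=T_Lx-y\\ \dot y=D_Lx-a_L\end{cases}\ \text{for } x<0,\qquad \begin{cases}\dot x=T_Rx-y\\ \dot y=D_Rx-a_R\end{cases}\ \text{for } x>0,\tag{cf}$$ with real parameters $T_L,D_L,a_L,T_R,D_R,a_R$, and trajectories understood in the sense of Filippov. Put $$\xi=a_RT_L-a_LT_R,\qquad c_0=a_Ra_L(a_RT_L-a_LT_R),\qquad c_\infty=T_L\left(T_L^2D_R-T_R^2D_L\right).$$ *Half-maps.* The forward Poincaré half-map $y_L$ sends $y_0\ge 0$ to $y_1$ if the orbit of the left system that starts at $(0,y_0)$ stays in $\{x<0\}$ for all times $t\in(0,\tau)$ and is at $(0,y_1)$ at time $\tau$, for some $\tau>0$; moreover $y_L(0)=0$ if there are pairs $y_0>0>y_1=y_L(y_0)$ arbitrarily close to $(0,0)$. The backward half-map $y_R$ is defined in the same way with the right system, $\{x>0\}$ and times $t\in(\tau,0)$ for some $\tau<0$. A half-map exists if its domain is non-empty. *Monodromic singularities.* A point off $\Sigma$ is a monodromic singularity if it is a focus or a center of the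 linear system of its zone, that is, an equilibrium of it whose eigenvalues are not real. A point of $\Sigma$ is a monodromic singularity if it is the origin and, moreover, ($a_L>0$, or $a_L=0$ and $4D_L-T_L^2>0$) and ($a_R<0$, or $a_R=0$ and $4D_R-T_R^2>0$). *Limit cycles.* A closed orbit is the trace of a non-constant periodic trajectory. A limit cycle is a closed orbit that meets $\Sigma$, meets it only at points where both vector fields are transversal to $\Sigma$ and point to the same side, and has a neighbourhood that contains no other closed orbit. **Statement.** Suppose that $T_LT_R<0$, $c_0\neq0$, both half-maps $y_L$ and $y_R$ exist, (cf) has a unique monodromic singularity, $4D_L-T_L^2>0$ and $4D_R-T_R^2>0$. If $\xi\,c_\infty>0$, then (cf) has a limit cycle. -/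

import Mathlib

open Set MeasureTheory

/-- Parameters of the planar piecewise linear system in Liénard canonical form
`x' = TL x - y, y' = DL x - aL` for `x < 0` and `x' = TR x - y, y' = DR x - aR` for `x > 0`. -/
structure LienardPWL where
  TL : ℝ
  DL : ℝ
  aL : ℝ
  TR : ℝ
  DR : ℝ
  aR : ℝ

namespace LienardPWL

/-- The affine vector field `(x, y) ↦ (T x - y, D x - a)`. -/
def field (T D a : ℝ) (p : ℝ × ℝ) : ℝ × ℝ := (T * p.1 - p.2, D * p.1 - a)

/-- The linear part of `field T D a`. -/
def linPart (T D : ℝ) : Matrix (Fin 2) (Fin 2) ℝ := !![T, -1; D, 0]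

/-- The vector field of the left zone `x < 0`. -/
def leftField (S : LienardPWL) : ℝ × ℝ → ℝ × ℝ := field S.TL S.DL S.aL

/-- The vector field of the right zone `x > 0`. -/
def rightField (S : LienardPWL) : ℝ × ℝ → ℝ × ℝ := field S.TR S.DR S.aR

/-- The switching line `x = 0`. -/
def switchingLine : Set (ℝ × ℝ) := {p | p.1 = 0}

open Classical in
/-- The set-valued vector field of Filippov's convention: single-valued off the switching line,
and on the switching line the convex hull of the two one-sided values. -/
noncomputable def filippov (S : LienardPWL) (p : ℝ × ℝ) : Set (ℝ × ℝ) :=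
  if p.1 < 0 then {S.leftField p}
  else if 0 < p.1 then {S.rightField p}
  else segment ℝ (S.leftField p) (S.rightField p)

/-- A Filippov solution defined for all times: a locally absolutely continuous curve which
satisfies the differential inclusion at almost every time. -/
def IsSolution (S : LienardPWL) (γ : ℝ → ℝ × ℝ) : Prop :=
  (∀ a b : ℝ, AbsolutelyContinuousOnInterval γ a b) ∧
    ∀ᵐ t : ℝ, ∃ v ∈ S.filippov (γ t), HasDerivAt γ v t

/-- A (non-trivial) closed orbit: the trace of a non-constant periodic solution. -/
def IsClosedOrbit (S : LienardPWL) (Γ : Set (ℝ × ℝ)) : Prop :=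
  ∃ γ : ℝ → ℝ × ℝ, ∃ P : ℝ, S.IsSolution γ ∧ 0 < P ∧ Function.Periodic γ P ∧
    (∃ s t : ℝ, γ s ≠ γ t) ∧ Γ = range γ

/-- A point of the switching line at which both fields are transversal to the line and point
to the same side of it. -/
def IsCrossingPoint (S : LienardPWL) (p : ℝ × ℝ) : Prop :=
  p ∈ switchingLine ∧ 0 < (S.leftField p).1 * (S.rightField p).1

/-- A closed crossing orbit: it meets the switching line, and only at crossing points. -/
def IsCrossingClosedOrbit (S : LienardPWL) (Γ : Set (ℝ × ℝ)) : Prop :=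
  S.IsClosedOrbit Γ ∧ (Γ ∩ switchingLine).Nonempty ∧
    ∀ p ∈ Γ ∩ switchingLine, S.IsCrossingPoint p

/-- A limit cycle: a closed crossing orbit that is isolated from other closed orbits, that is,
some neighbourhood of it contains no other closed orbit. -/
def IsLimitCycle (S : LienardPWL) (Γ : Set (ℝ × ℝ)) : Prop :=
  S.IsCrossingClosedOrbit Γ ∧
    ∃ U : Set (ℝ × ℝ), IsOpen U ∧ Γ ⊆ U ∧ ∀ Γ' : Set (ℝ × ℝ), S.IsClosedOrbit Γ' → Γ' ⊆ U → Γ' = Γ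

/-- The orbit of `(0, y₀)` enters `x < 0` and first returns to the switching line, in forward
time, at `(0, y₁)`. -/
def ForwardReturn (S : LienardPWL) (y₀ y₁ : ℝ) : Prop :=
  ∃ φ : ℝ → ℝ × ℝ, ∃ τ : ℝ, (∀ t, HasDerivAt φ (S.leftField (φ t)) t) ∧ φ 0 = (0, y₀) ∧
    0 < τ ∧ φ τ = (0, y₁) ∧ ∀ t ∈ Ioo 0 τ, (φ t).1 < 0

/-- The orbit of `(0, y₀)` comes from `x > 0`, and in backward time it first returns to the
switching line at `(0, y₁)`. -/
def BackwardReturn (S : LienardPWL) (y₀ y₁ : ℝ) : Prop :=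
  ∃ φ : ℝ → ℝ × ℝ, ∃ τ : ℝ, (∀ t, HasDerivAt φ (S.rightField (φ t)) t) ∧ φ 0 = (0, y₀) ∧
    τ < 0 ∧ φ τ = (0, y₁) ∧ ∀ t ∈ Ioo τ 0, 0 < (φ t).1

/-- The Poincaré half-map (as a relation) built from a return relation `R`: its graph on
`y₀ ≥ 0`, together with `0 ↦ 0` when the return relation has points `(y₀, y₁)` arbitrarily
close to `(0, 0)` with `y₀ > 0 > y₁`. -/
def halfMap (R : ℝ → ℝ → Prop) (y₀ y₁ : ℝ) : Prop :=
  (0 ≤ y₀ ∧ R y₀ y₁) ∨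
    (y₀ = 0 ∧ y₁ = 0 ∧ ∀ ε > 0, ∃ u ∈ Ioo 0 ε, ∃ v ∈ Ioo (-ε) 0, R u v)

/-- The forward Poincaré half-map `y_L` exists: its domain is non-empty. -/
def ForwardHalfMapExists (S : LienardPWL) : Prop :=
  ∃ y₀ y₁ : ℝ, halfMap S.ForwardReturn y₀ y₁

/-- The backward Poincaré half-map `y_R` exists: its domain is non-empty. -/
def BackwardHalfMapExists (S : LienardPWL) : Prop :=
  ∃ y₀ y₁ : ℝ, halfMap S.BackwardReturn y₀ y₁

/-- `p` is a focus or a center of the affine field: an equilibrium at which the linear part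
has no real eigenvalue. -/
def IsFocusOrCenter (T D a : ℝ) (p : ℝ × ℝ) : Prop :=
  field T D a p = 0 ∧ spectrum ℝ (linPart T D) = ∅

/-- Monodromic singularities: foci and centers off the switching line, and the origin when
there is a half-rotation around it in both closed half-planes. -/
def IsMonodromicSingularity (S : LienardPWL) (p : ℝ × ℝ) : Prop :=
  (p.1 < 0 ∧ IsFocusOrCenter S.TL S.DL S.aL p) ∨
  (0 < p.1 ∧ IsFocusOrCenter S.TR S.DR S.aR p) ∨
  (p = 0 ∧ (0 < S.aL ∨ (S.aL = 0 ∧ 0 < 4 * S.DL - S.TL ^ 2)) ∧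
    (S.aR < 0 ∨ (S.aR = 0 ∧ 0 < 4 * S.DR - S.TR ^ 2)))

/-- `ξ = a_R T_L - a_L T_R`. -/
def xi (S : LienardPWL) : ℝ := S.aR * S.TL - S.aL * S.TR

/-- `c₀ = a_R a_L (a_R T_L - a_L T_R)`. -/
def c0 (S : LienardPWL) : ℝ := S.aR * S.aL * (S.aR * S.TL - S.aL * S.TR)

/-- `c_∞ = T_L (T_L² D_R - T_R² D_L)`. -/
def cInf (S : LienardPWL) : ℝ := S.TL * (S.TL ^ 2 * S.DR - S.TR ^ 2 * S.DL)

end LienardPWL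

open Filter Topology

namespace LienardPWL

/-! ### The logarithmic potential on the switching line -/

/-! In complex coordinates centred at its equilibrium a focus is `z' = λ z`, so `log |z|` minus a
multiple of the angle is a first integral. Restricted to the switching line it is `potential`, whose
derivative is `y` over a positive quadratic: it decreases for `y < 0` and increases for `y > 0`. An
arc in `x < 0` from `(0, y₀)` to `(0, y₁)` therefore exists exactly when `defect` vanishes
(`IsArc.defect_eq_zero`, `exists_isArc`), with an additional angle `2π` if the equilibrium lies in
the zone, that is, if `a < 0`.

The map `(x, y, t) ↦ (-x, y, -t)` turns the right system into a left one with parameters `-TR, DR,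
-aR`. Crossing closed orbits thus correspond to common zeros, with `y₀ > 0 > y₁`, of two defects
whose traces have the same sign.

A common zero comes from a change of sign of the second defect along the zero curve of the first.
For traces made positive, the second defect tends at infinity to `π (k₁ - k₂)`, where `k = T /
(2ω)`; this has the sign of `c_∞`, hence that of `ξ` (`exists_far_defect_pos`). Near the origin it
takes the sign opposite to `ξ`: by an expansion to third order if both foci are virtual
(`exists_near_defect_neg`), and because the arc of a real expanding focus ends away from the origin
otherwise (`exists_near_defect_pos`). Uniqueness of the monodromic singularity excludes two real
foci. The defect along the curve is analytic and not identically zero, so its zeros are isolated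
(`hasIsolatedCommonZero_of_sign_change`).

An isolated common zero gives an isolated closed orbit (`exists_isLimitCycle`). The two arcs glue to
a periodic Filippov solution; conversely, every closed orbit that avoids the origin passes through a
common zero (`IsClassicalSolution.exists_common_zero`) and is determined by it. -/

/-- The angular velocity `√(4 D - T ^ 2) / 2` of a focus. -/
noncomputable def freq (T D : ℝ) : ℝ := √(4 * D - T ^ 2) / 2

/-- The imaginary part, in complex coordinates centred at the focus, of the points
of the switching line, up to sign. -/
noncomputable def height (T D a : ℝ) : ℝ := freq T D * (a / D)

/-- The real part, in complex coordinates centred at the focus, of the point `(0, y)`. -/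
noncomputable def offset (T D a y : ℝ) : ℝ := T / 2 * (a / D) - y

/-- The logarithm of the modulus of `(0, y)`, corrected by its angle, in complex coordinates centred
at the focus; the correction makes it a first integral of the linear flow. -/
noncomputable def potential (T D a y : ℝ) : ℝ :=
  Real.log (offset T D a y ^ 2 + height T D a ^ 2) / 2 -
    T / 2 / freq T D * Real.arctan (offset T D a y / height T D a)

/-- The additional angle swept by an orbit arc that goes around the focus. -/
noncomputable def turn (a : ℝ) : ℝ := if 0 < a then 0 else 2 * Real.pi

/-- The function that vanishes at `(y₀, y₁)` when an orbit arc in `x < 0` joins `(0, y₀)`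
to `(0, y₁)`. -/
noncomputable def defect (T D a y₀ y₁ : ℝ) : ℝ :=
  potential T D a y₁ - potential T D a y₀ - T / 2 / freq T D * turn a

section Potential

variable {T D a : ℝ}

lemma det_pos (hf : 0 < 4 * D - T ^ 2) : 0 < D := by nlinarith [sq_nonneg T]

lemma freq_pos (hf : 0 < 4 * D - T ^ 2) : 0 < freq T D := by
  unfold freq; positivity

lemma freq_sq (hf : 0 < 4 * D - T ^ 2) : freq T D ^ 2 = D - T ^ 2 / 4 := by
  rw [freq, div_pow, Real.sq_sqrt hf.le]; ring

lemma height_ne_zero (hf : 0 < 4 * D - T ^ 2) (ha : a ≠ 0) : height T D a ≠ 0 :=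
  mul_ne_zero (freq_pos hf).ne' (div_ne_zero ha (det_pos hf).ne')

lemma modulus_pos (hf : 0 < 4 * D - T ^ 2) (ha : a ≠ 0) (y : ℝ) :
    0 < offset T D a y ^ 2 + height T D a ^ 2 := by
  have := height_ne_zero hf ha
  positivity

lemma modulus_eq (hf : 0 < 4 * D - T ^ 2) (y : ℝ) :
    offset T D a y ^ 2 + height T D a ^ 2 = (D * y ^ 2 - a * T * y + a ^ 2) / D := by
  have := (det_pos hf).ne'
  rw [height, mul_pow, freq_sq hf, offset]
  field_simp
  ring

/-- The numerator is just `y` because the orbits are tangent to the switching line only at `y = 0`.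
All monotonicity of the half-maps comes from this sign. -/
lemma hasDerivAt_potential (hf : 0 < 4 * D - T ^ 2) (ha : a ≠ 0) (y : ℝ) :
    HasDerivAt (potential T D a) (y / (offset T D a y ^ 2 + height T D a ^ 2)) y := by
  have h0 := height_ne_zero hf ha
  have hm := modulus_pos hf ha y
  have hq : HasDerivAt (offset T D a) (-1) y := (hasDerivAt_id y).const_sub (T / 2 * (a / D))
  have h1 := (((hq.pow 2).add_const (height T D a ^ 2)).log hm.ne').div_const 2
  have h2 := ((hq.div_const (height T D a)).arctan).const_mul (T / 2 / freq T D)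
  refine HasDerivAt.congr_deriv (f := potential T D a) (h1.sub h2) ?_
  have hw := (freq_pos hf).ne'
  have hk : T / 2 / freq T D * height T D a = T / 2 * (a / D) := by
    rw [height]; field_simp
  -- The right-hand side is the numerator left by differentiating the logarithm and the arctangent.
  have hy : y = T / 2 / freq T D * height T D a - offset T D a y := by rw [hk, offset]; ring
  have hh : 0 < 1 + (offset T D a y / height T D a) ^ 2 := by positivity
  simp only [Nat.cast_ofNat, Nat.add_one_sub_one, pow_one, Pi.pow_apply]
  generalize T / 2 / freq T D = k at *
  generalize height T D a = h at *
  generalize offset T D a y = q at *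
  subst hy
  have e : 1 + (q / h) ^ 2 = (q ^ 2 + h ^ 2) / h ^ 2 := by field_simp; ring
  rw [e]
  field_simp
  ring

lemma analyticAt_potential (hf : 0 < 4 * D - T ^ 2) (ha : a ≠ 0) (y : ℝ) :
    AnalyticAt ℝ (potential T D a) y := by
  have hq : AnalyticAt ℝ (offset T D a) y := analyticAt_const.sub analyticAt_id
  have h1 : AnalyticAt ℝ (fun y ↦ Real.log (offset T D a y ^ 2 + height T D a ^ 2)) y :=
    ((hq.pow 2).add analyticAt_const).log (modulus_pos hf ha y)
  have h2 : AnalyticAt ℝ (fun y ↦ Real.arctan (offset T D a y / height T D a)) y :=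
    (Real.contDiff_arctan.contDiffAt.analyticAt).comp
      (hq.div analyticAt_const (height_ne_zero hf ha))
  exact (h1.div analyticAt_const two_ne_zero).sub (analyticAt_const.mul h2)

lemma continuous_potential (hf : 0 < 4 * D - T ^ 2) (ha : a ≠ 0) :
    Continuous (potential T D a) :=
  continuous_iff_continuousAt.2 fun y ↦ (hasDerivAt_potential hf ha y).continuousAt

lemma strictMonoOn_potential (hf : 0 < 4 * D - T ^ 2) (ha : a ≠ 0) :
    StrictMonoOn (potential T D a) (Ici 0) :=
  strictMonoOn_of_deriv_pos (convex_Ici 0) (continuous_potential hf ha).continuousOn fun y hy ↦ by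
    rw [interior_Ici] at hy
    rw [(hasDerivAt_potential hf ha y).deriv]
    exact div_pos hy (modulus_pos hf ha y)

lemma strictAntiOn_potential (hf : 0 < 4 * D - T ^ 2) (ha : a ≠ 0) :
    StrictAntiOn (potential T D a) (Iic 0) :=
  strictAntiOn_of_deriv_neg (convex_Iic 0) (continuous_potential hf ha).continuousOn fun y hy ↦ by
    rw [interior_Iic] at hy
    rw [(hasDerivAt_potential hf ha y).deriv]
    exact div_neg_of_neg_of_pos hy (modulus_pos hf ha y)

lemma freq_neg : freq (-T) D = freq T D := by simp [freq]

lemma potential_neg (y : ℝ) : potential (-T) D a (-y) = potential T D a y := by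
  have h1 : offset (-T) D a (-y) = - offset T D a y := by simp only [offset]; ring
  have h2 : height (-T) D a = height T D a := by simp only [height, freq_neg]
  rw [potential, potential, h1, h2, freq_neg, neg_div (height T D a), Real.arctan_neg, neg_sq]
  ring

/-- The symmetry `(x, y, t) ↦ (x, -y, -t)` changes the sign of the trace and exchanges the ends of
an arc. It reduces everything to expanding foci. -/
lemma defect_neg (y₀ y₁ : ℝ) : defect (-T) D a (-y₁) (-y₀) = - defect T D a y₀ y₁ := by
  simp only [defect, potential_neg, freq_neg]; ring

lemma offset_tendsto_atTop : Tendsto (offset T D a) atTop atBot := by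
  unfold offset
  exact tendsto_atBot_add_const_left _ _ tendsto_neg_atTop_atBot

lemma offset_tendsto_atBot : Tendsto (offset T D a) atBot atTop := by
  unfold offset
  exact tendsto_atTop_add_const_left _ _ tendsto_neg_atBot_atTop

lemma potential_tendsto_of_abs {l : Filter ℝ}
    (h : Tendsto (fun y ↦ offset T D a y ^ 2) l atTop) : Tendsto (potential T D a) l atTop := by
  have h1 : Tendsto (fun y ↦ Real.log (offset T D a y ^ 2 + height T D a ^ 2) / 2) l atTop :=
    (Real.tendsto_log_atTop.comp (tendsto_atTop_add_const_right _ _ h)).atTop_div_const two_pos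
  refine tendsto_atTop_add_right_of_le _ (-(|T / 2 / freq T D| * (Real.pi / 2))) h1 fun y ↦ ?_
  rw [neg_le_neg_iff]
  refine (le_abs_self _).trans ?_
  rw [abs_mul]
  gcongr
  rw [abs_le]
  exact ⟨(Real.neg_pi_div_two_lt_arctan _).le, (Real.arctan_lt_pi_div_two _).le⟩

lemma potential_tendsto_atTop : Tendsto (potential T D a) atTop atTop :=
  potential_tendsto_of_abs <| by
    simpa [Function.comp_def] using (tendsto_pow_atTop (two_ne_zero)).comp
      (tendsto_abs_atBot_atTop.comp (offset_tendsto_atTop (T := T) (D := D) (a := a)))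

lemma potential_tendsto_atBot : Tendsto (potential T D a) atBot atTop :=
  potential_tendsto_of_abs <|
    (tendsto_pow_atTop (two_ne_zero)).comp offset_tendsto_atBot

/-- Every level above the minimum is attained on the negative half-line. -/
lemma exists_neg_potential_eq (hf : 0 < 4 * D - T ^ 2) (ha : a ≠ 0) {e : ℝ}
    (he : potential T D a 0 < e) : ∃ y < 0, potential T D a y = e := by
  obtain ⟨m, hm0, hm⟩ := ((eventually_lt_atBot (0 : ℝ)).and
    (potential_tendsto_atBot.eventually_gt_atTop e)).exists
  obtain ⟨y, hy, rfl⟩ := intermediate_value_Ioo' hm0.le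
    (continuous_potential hf ha).continuousOn ⟨he, hm⟩
  exact ⟨y, hy.2, rfl⟩

lemma defect_right_inj (hf : 0 < 4 * D - T ^ 2) (ha : a ≠ 0) {y₀ u v : ℝ} (hu : u ≤ 0) (hv : v ≤ 0)
    (h1 : defect T D a y₀ u = 0) (h2 : defect T D a y₀ v = 0) : u = v :=
  (strictAntiOn_potential hf ha).injOn hu hv (by unfold defect at *; linarith)

lemma defect_left_inj (hf : 0 < 4 * D - T ^ 2) (ha : a ≠ 0) {y₁ u v : ℝ} (hu : 0 ≤ u) (hv : 0 ≤ v)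
    (h1 : defect T D a u y₁ = 0) (h2 : defect T D a v y₁ = 0) : u = v :=
  (strictMonoOn_potential hf ha).injOn hu hv (by unfold defect at *; linarith)

end Potential


/-! ### Common zeros of two defects -/

section Analysis

variable {T D a T₁ D₁ a₁ T₂ D₂ a₂ : ℝ}

lemma turn_nonneg : 0 ≤ turn a := by
  unfold turn; split_ifs <;> positivity

lemma log_modulus_sub_tendsto (hf : 0 < 4 * D - T ^ 2) (ha : a ≠ 0) {l : Filter ℝ}
    (hl : Tendsto (fun y : ℝ ↦ y⁻¹) l (𝓝 0)) (h0 : ∀ᶠ y in l, y ≠ 0) :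
    Tendsto (fun y ↦ Real.log (offset T D a y ^ 2 + height T D a ^ 2) / 2 - Real.log |y|)
      l (𝓝 0) := by
  have h1 : Tendsto (fun y : ℝ ↦ Real.log ((T / 2 * (a / D) * y⁻¹ - 1) ^ 2 +
      height T D a ^ 2 * (y⁻¹) ^ 2) / 2) l (𝓝 0) := by
    have h2 : Tendsto (fun y : ℝ ↦ (T / 2 * (a / D) * y⁻¹ - 1) ^ 2 +
        height T D a ^ 2 * (y⁻¹) ^ 2) l (𝓝 1) := by
      have := (((hl.const_mul (T / 2 * (a / D))).sub_const 1).pow 2).add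
        ((hl.pow 2).const_mul (height T D a ^ 2))
      simpa using this
    have h3 := ((Real.continuousAt_log one_ne_zero).tendsto.comp h2).div_const 2
    simpa using h3
  refine h1.congr' ?_
  filter_upwards [h0] with y hy
  have hm := modulus_pos hf ha y
  have e : (T / 2 * (a / D) * y⁻¹ - 1) ^ 2 + height T D a ^ 2 * (y⁻¹) ^ 2 =
      (offset T D a y ^ 2 + height T D a ^ 2) / y ^ 2 := by
    rw [offset]; field_simp
  rw [e, Real.log_div hm.ne' (pow_ne_zero 2 hy), Real.log_pow, Real.log_abs]
  push_cast
  ring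

lemma height_pos_iff (hf : 0 < 4 * D - T ^ 2) : 0 < height T D a ↔ 0 < a := by
  rw [height, mul_pos_iff_of_pos_left (freq_pos hf), div_pos_iff_of_pos_right (det_pos hf)]

lemma height_neg (hf : 0 < 4 * D - T ^ 2) (ha : a ≠ 0) (h : ¬ 0 < a) : height T D a < 0 :=
  lt_of_le_of_ne (not_lt.1 fun h' ↦ h ((height_pos_iff hf).1 h')) (height_ne_zero hf ha)

/-- The limit is `-π/2` for `a > 0` and `π/2` for `a < 0`. Writing it through `turn a` lets the
contribution of the sign of `a` cancel in `exists_far_defect_pos`. -/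
lemma angle_tendsto_atTop (hf : 0 < 4 * D - T ^ 2) (ha : a ≠ 0) :
    Tendsto (fun y ↦ Real.arctan (offset T D a y / height T D a)) atTop
      (𝓝 (turn a / 2 - Real.pi / 2)) := by
  by_cases h : 0 < a
  · have h1 := (offset_tendsto_atTop (T := T) (D := D) (a := a)).atBot_div_const
      ((height_pos_iff hf).2 h)
    have := (tendsto_nhds_of_tendsto_nhdsWithin Real.tendsto_arctan_atBot).comp h1
    simpa [turn, h, neg_div, Function.comp_def] using this
  · have h1 := (offset_tendsto_atTop (T := T) (D := D) (a := a)).atBot_mul_const_of_neg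
      (inv_neg''.2 (height_neg hf ha h))
    have := (tendsto_nhds_of_tendsto_nhdsWithin Real.tendsto_arctan_atTop).comp h1
    have e : Real.pi - Real.pi / 2 = Real.pi / 2 := by ring
    simpa [turn, h, e, Function.comp_def, div_eq_mul_inv _ (height T D a)] using this

lemma angle_tendsto_atBot (hf : 0 < 4 * D - T ^ 2) (ha : a ≠ 0) :
    Tendsto (fun y ↦ Real.arctan (offset T D a y / height T D a)) atBot
      (𝓝 (-(turn a / 2 - Real.pi / 2))) := by
  by_cases h : 0 < a
  · have h1 := (offset_tendsto_atBot (T := T) (D := D) (a := a)).atTop_div_const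
      ((height_pos_iff hf).2 h)
    have := (tendsto_nhds_of_tendsto_nhdsWithin Real.tendsto_arctan_atTop).comp h1
    simpa [turn, h, neg_div, Function.comp_def] using this
  · have h1 := (offset_tendsto_atBot (T := T) (D := D) (a := a)).atTop_mul_const_of_neg
      (inv_neg''.2 (height_neg hf ha h))
    have := (tendsto_nhds_of_tendsto_nhdsWithin Real.tendsto_arctan_atBot).comp h1
    have e : Real.pi / 2 - Real.pi = - (Real.pi / 2) := by ring
    simpa [turn, h, e, Function.comp_def, div_eq_mul_inv _ (height T D a)] using this

lemma potential_sub_log_tendsto_atTop (hf : 0 < 4 * D - T ^ 2) (ha : a ≠ 0) :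
    Tendsto (fun y ↦ potential T D a y - Real.log |y|) atTop
      (𝓝 (-(T / 2 / freq T D * (turn a / 2 - Real.pi / 2)))) := by
  have := (log_modulus_sub_tendsto hf ha tendsto_inv_atTop_zero (eventually_ne_atTop 0)).sub
    ((angle_tendsto_atTop hf ha).const_mul (T / 2 / freq T D))
  rw [zero_sub] at this
  refine this.congr fun y ↦ ?_
  rw [potential]; ring

lemma potential_sub_log_tendsto_atBot (hf : 0 < 4 * D - T ^ 2) (ha : a ≠ 0) :
    Tendsto (fun y ↦ potential T D a y - Real.log |y|) atBot
      (𝓝 (T / 2 / freq T D * (turn a / 2 - Real.pi / 2))) := by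
  have := (log_modulus_sub_tendsto hf ha tendsto_inv_atBot_zero (eventually_ne_atBot 0)).sub
    ((angle_tendsto_atBot hf ha).const_mul (T / 2 / freq T D))
  rw [zero_sub, mul_neg, neg_neg] at this
  refine this.congr fun y ↦ ?_
  rw [potential]; ring

/-- An orbit arc starts from every point `(0, y₀)`, `y₀ > 0`, of an expanding focus. -/
lemma exists_defect_eq_zero (hf : 0 < 4 * D - T ^ 2) (ha : a ≠ 0) (hT : 0 < T) {y₀ : ℝ}
    (hy : 0 < y₀) : ∃ y₁ < 0, defect T D a y₀ y₁ = 0 := by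
  have hk : 0 ≤ T / 2 / freq T D * turn a :=
    mul_nonneg (div_nonneg (by linarith) (freq_pos hf).le) turn_nonneg
  have h0 := strictMonoOn_potential hf ha (mem_Ici.2 le_rfl) (mem_Ici.2 hy.le) hy
  obtain ⟨y₁, h1, h2⟩ := exists_neg_potential_eq hf ha
    (e := potential T D a y₀ + T / 2 / freq T D * turn a) (by linarith)
  exact ⟨y₁, h1, by rw [defect, h2]; ring⟩

/-- The sign of one defect along the zeros of the other one, far from the origin. -/
lemma exists_far_defect_pos (hf₁ : 0 < 4 * D₁ - T₁ ^ 2) (hf₂ : 0 < 4 * D₂ - T₂ ^ 2)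
    (ha₁ : a₁ ≠ 0) (ha₂ : a₂ ≠ 0) (hT₁ : 0 < T₁) {c : ℝ}
    (hc : 0 < c * (T₁ / 2 / freq T₁ D₁ - T₂ / 2 / freq T₂ D₂)) :
    ∃ y₀ > 0, ∃ y₁ < 0, defect T₁ D₁ a₁ y₀ y₁ = 0 ∧ 0 < c * defect T₂ D₂ a₂ y₀ y₁ := by
  set k₁ := T₁ / 2 / freq T₁ D₁ with hk₁
  set k₂ := T₂ / 2 / freq T₂ D₂ with hk₂
  have htop := (potential_sub_log_tendsto_atTop hf₂ ha₂).sub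
    (potential_sub_log_tendsto_atTop hf₁ ha₁)
  have hbot := (potential_sub_log_tendsto_atBot hf₂ ha₂).sub
    (potential_sub_log_tendsto_atBot hf₁ ha₁)
  simp only [sub_sub_sub_cancel_right, ← hk₁, ← hk₂] at htop hbot
  have hprod := ((((hbot.comp tendsto_snd).sub (htop.comp tendsto_fst)).add_const
    (k₁ * turn a₁ - k₂ * turn a₂)).const_mul c)
  -- All `turn` terms cancel and the limit is `c * π * (k₁ - k₂)`.
  have hlim : 0 < c * (k₂ * (turn a₂ / 2 - Real.pi / 2) - k₁ * (turn a₁ / 2 - Real.pi / 2) -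
      (-(k₂ * (turn a₂ / 2 - Real.pi / 2)) - -(k₁ * (turn a₁ / 2 - Real.pi / 2))) +
      (k₁ * turn a₁ - k₂ * turn a₂)) := by
    have := mul_pos hc Real.pi_pos
    linarith
  have hev := hprod.eventually (lt_mem_nhds hlim)
  obtain ⟨p, hp, q, hq, hpq⟩ := eventually_prod_iff.1 hev
  obtain ⟨N, hN⟩ := eventually_atBot.1 hq
  -- The last condition makes `y₀` so large that the end `y₁` of its arc is forced below `N`.
  obtain ⟨y₀, hy₀, hpy, hG⟩ := ((eventually_gt_atTop (0 : ℝ)).and (hp.and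
    ((potential_tendsto_atTop (T := T₁) (D := D₁) (a := a₁)).eventually_gt_atTop
      (potential T₁ D₁ a₁ (min N 0))))).exists
  obtain ⟨y₁, hy₁, hE⟩ := exists_defect_eq_zero hf₁ ha₁ hT₁ hy₀
  have hkt : 0 ≤ k₁ * turn a₁ :=
    mul_nonneg (div_nonneg (by linarith) (freq_pos hf₁).le) turn_nonneg
  have hE' : potential T₁ D₁ a₁ y₁ - potential T₁ D₁ a₁ y₀ - k₁ * turn a₁ = 0 := hE
  have hy₁N : y₁ ≤ N := by
    by_contra! h
    have := (strictAntiOn_potential hf₁ ha₁).antitoneOn (mem_Iic.2 (min_le_right N 0))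
      (mem_Iic.2 hy₁.le) ((min_le_left N 0).trans h.le)
    linarith
  refine ⟨y₀, hy₀, y₁, hy₁, hE, ?_⟩
  have := hpq hpy (hN _ hy₁N)
  simp only [Function.comp_apply] at this
  refine this.trans_eq (congrArg (c * ·) ?_)
  rw [defect, ← hk₂]
  linarith

/-- The sign of one defect along the zeros of the other one near the origin,
when both foci are virtual. -/
lemma exists_near_defect_neg (hf₁ : 0 < 4 * D₁ - T₁ ^ 2) (hf₂ : 0 < 4 * D₂ - T₂ ^ 2)
    (ha₁ : 0 < a₁) (ha₂ : 0 < a₂) (hξ : a₁ * T₂ - a₂ * T₁ ≠ 0) :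
    ∃ y₀ > 0, ∃ y₁ < 0, defect T₁ D₁ a₁ y₀ y₁ = 0 ∧
      (a₁ * T₂ - a₂ * T₁) * defect T₂ D₂ a₂ y₀ y₁ < 0 := by
  set ξ := a₁ * T₂ - a₂ * T₁ with hξdef
  have hD₁ := det_pos hf₁
  have hD₂ := det_pos hf₂
  -- The ratio of the two moduli at `y = 0`. Subtracting `r` times the first potential cancels the
  -- term of order two, and the cubic term that remains has the sign of `ξ`; the factor `ξ` in `H`
  -- makes it positive.
  set r := (a₁ ^ 2 / D₁) * (D₂ / a₂ ^ 2) with hr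
  set m := a₁ * ξ ^ 2 / (a₂ * D₁) with hm
  have hmpos : 0 < m := by positivity
  let H : ℝ → ℝ := fun y ↦ ξ * (potential T₂ D₂ a₂ y - r * potential T₁ D₁ a₁ y)
  have hH : ∀ y, HasDerivAt H (y ^ 2 * (ξ * (1 - r) * y + m) /
      ((offset T₁ D₁ a₁ y ^ 2 + height T₁ D₁ a₁ ^ 2) *
        (offset T₂ D₂ a₂ y ^ 2 + height T₂ D₂ a₂ ^ 2))) y := fun y ↦ by
    refine (((hasDerivAt_potential hf₂ ha₂.ne' y).sub
      ((hasDerivAt_potential hf₁ ha₁.ne' y).const_mul r)).const_mul ξ).congr_deriv ?_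
    have h1 := (modulus_pos hf₁ ha₁.ne' y).ne'
    have h2 := (modulus_pos hf₂ ha₂.ne' y).ne'
    have e : y ^ 2 * (ξ * (1 - r) * y + m) = ξ * (y *
        (offset T₁ D₁ a₁ y ^ 2 + height T₁ D₁ a₁ ^ 2) -
        r * y * (offset T₂ D₂ a₂ y ^ 2 + height T₂ D₂ a₂ ^ 2)) := by
      rw [modulus_eq hf₁, modulus_eq hf₂, hm, hr, hξdef]
      field_simp
      ring
    rw [e]
    field_simp
  have hHc : Continuous H := continuous_iff_continuousAt.2 fun y ↦ (hH y).continuousAt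
  obtain ⟨δ, hδ, hδm⟩ : ∃ δ > 0, ∀ y, |y| < δ → 0 < ξ * (1 - r) * y + m := by
    have hc : Continuous fun y : ℝ ↦ ξ * (1 - r) * y + m := by fun_prop
    have := (hc.tendsto 0).eventually (lt_mem_nhds (by simpa using hmpos))
    obtain ⟨δ, hδ, h⟩ := Metric.eventually_nhds_iff.1 this
    exact ⟨δ, hδ, fun y hy ↦ h (by simpa using hy)⟩
  have hpos : ∀ y, y ≠ 0 → |y| < δ → 0 < deriv H y := fun y hy hyd ↦ by
    rw [(hH y).deriv]
    have h1 := modulus_pos hf₁ ha₁.ne' y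
    have h2 := modulus_pos hf₂ ha₂.ne' y
    have h3 := hδm y hyd
    positivity
  have hmono₁ : StrictMonoOn H (Icc (-δ) 0) :=
    strictMonoOn_of_deriv_pos (convex_Icc _ _) hHc.continuousOn fun y hy ↦ by
      rw [interior_Icc] at hy
      exact hpos y hy.2.ne (abs_lt.2 ⟨hy.1, hy.2.trans hδ⟩)
  have hmono₂ : StrictMonoOn H (Icc 0 δ) :=
    strictMonoOn_of_deriv_pos (convex_Icc _ _) hHc.continuousOn fun y hy ↦ by
      rw [interior_Icc] at hy
      exact hpos y hy.1.ne' (abs_lt.2 ⟨by linarith [hy.1], hy.2⟩)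
  have hanti := strictAntiOn_potential hf₁ ha₁.ne'
  have hlt : potential T₁ D₁ a₁ 0 < potential T₁ D₁ a₁ (-δ) :=
    hanti (mem_Iic.2 (by linarith)) (mem_Iic.2 le_rfl) (by linarith)
  -- This keeps `y₁` in `(-δ, 0)`. Then `H` increases from `y₁` to `y₀`, while the first potential
  -- has the same value at both.
  have hev : ∀ᶠ y in 𝓝[>] (0 : ℝ), potential T₁ D₁ a₁ y < potential T₁ D₁ a₁ (-δ) :=
    ((continuous_potential hf₁ ha₁.ne').tendsto 0 |>.mono_left nhdsWithin_le_nhds).eventually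
      (gt_mem_nhds hlt)
  obtain ⟨y₀, hy, hy₀, hy₀δ⟩ := (hev.and (Ioo_mem_nhdsGT hδ)).exists
  have h0 := strictMonoOn_potential hf₁ ha₁.ne' (mem_Ici.2 le_rfl) (mem_Ici.2 hy₀.le) hy₀
  obtain ⟨y₁, hy₁, he⟩ := exists_neg_potential_eq hf₁ ha₁.ne' h0
  have hy₁δ : -δ < y₁ := by
    by_contra! h
    have := hanti.antitoneOn (mem_Iic.2 hy₁.le) (mem_Iic.2 (by linarith)) h
    linarith
  refine ⟨y₀, hy₀, y₁, hy₁, by simp [defect, turn, ha₁, he], ?_⟩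
  have h1 := hmono₁ ⟨hy₁δ.le, hy₁.le⟩ ⟨by linarith, le_rfl⟩ hy₁
  have h2 := hmono₂ ⟨le_rfl, hδ.le⟩ ⟨hy₀.le, hy₀δ.le⟩ hy₀
  have h3 := h1.trans h2
  simp only [H, he] at h3
  simp only [defect, turn, ha₂, if_true, mul_zero, sub_zero]
  linarith

/-- One defect is positive at some zeros of the other one near the origin, when the expanding focus
of the latter is real and the other one is virtual. -/
lemma exists_near_defect_pos (hf₁ : 0 < 4 * D₁ - T₁ ^ 2) (hf₂ : 0 < 4 * D₂ - T₂ ^ 2)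
    (hT₁ : 0 < T₁) (ha₁ : a₁ < 0) (ha₂ : 0 < a₂) :
    ∃ y₀ > 0, ∃ y₁ < 0, defect T₁ D₁ a₁ y₀ y₁ = 0 ∧ 0 < defect T₂ D₂ a₂ y₀ y₁ := by
  have hk : 0 < T₁ / 2 / freq T₁ D₁ * turn a₁ := by
    have := freq_pos hf₁
    have := Real.pi_pos
    rw [turn, if_neg ha₁.not_gt]
    positivity
  -- `v` is where the arc of the tangency point `y₀ = 0` ends. Arcs from `y₀ > 0` end below it,
  -- however small `y₀` is.
  obtain ⟨v, hv, he⟩ := exists_neg_potential_eq hf₁ ha₁.ne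
    (lt_add_of_pos_right (potential T₁ D₁ a₁ 0) hk)
  have hlt := strictAntiOn_potential hf₂ ha₂.ne' (mem_Iic.2 hv.le) (mem_Iic.2 le_rfl) hv
  have hev : ∀ᶠ y in 𝓝[>] (0 : ℝ), potential T₂ D₂ a₂ y < potential T₂ D₂ a₂ v :=
    ((continuous_potential hf₂ ha₂.ne').tendsto 0 |>.mono_left nhdsWithin_le_nhds).eventually
      (gt_mem_nhds hlt)
  obtain ⟨y₀, hy, hy₀⟩ := (hev.and self_mem_nhdsWithin).exists
  obtain ⟨y₁, hy₁, hE⟩ := exists_defect_eq_zero hf₁ ha₁.ne hT₁ hy₀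
  refine ⟨y₀, hy₀, y₁, hy₁, hE, ?_⟩
  have h0 := strictMonoOn_potential hf₁ ha₁.ne (mem_Ici.2 le_rfl) (mem_Ici.2 (le_of_lt hy₀)) hy₀
  have h1 : y₁ ≤ v := by
    by_contra! h
    have := strictAntiOn_potential hf₁ ha₁.ne (mem_Iic.2 hv.le) (mem_Iic.2 hy₁.le) h
    rw [defect] at hE
    linarith
  have h2 := (strictAntiOn_potential hf₂ ha₂.ne').antitoneOn (mem_Iic.2 hy₁.le) (mem_Iic.2 hv.le) h1
  simp only [defect, turn, ha₂, if_true, mul_zero, sub_zero]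
  linarith

/-- The defects of the two foci have a common zero in `y₀ > 0 > y₁` which is isolated
from other ones. -/
def HasIsolatedCommonZero (T₁ D₁ a₁ T₂ D₂ a₂ : ℝ) : Prop :=
  ∃ y₀ > 0, ∃ y₁ < 0, defect T₁ D₁ a₁ y₀ y₁ = 0 ∧ defect T₂ D₂ a₂ y₀ y₁ = 0 ∧
    ∃ ε > 0, ∀ u₀ > 0, ∀ u₁ < 0, |u₀ - y₀| < ε → |u₁ - y₁| < ε →
      defect T₁ D₁ a₁ u₀ u₁ = 0 → defect T₂ D₂ a₂ u₀ u₁ = 0 → u₀ = y₀ ∧ u₁ = y₁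

lemma HasIsolatedCommonZero.swap (h : HasIsolatedCommonZero T₁ D₁ a₁ T₂ D₂ a₂) :
    HasIsolatedCommonZero T₂ D₂ a₂ T₁ D₁ a₁ := by
  obtain ⟨y₀, h0, y₁, h1, hE₁, hE₂, ε, hε, h⟩ := h
  exact ⟨y₀, h0, y₁, h1, hE₂, hE₁, ε, hε, fun u₀ hu₀ u₁ hu₁ hd₀ hd₁ e₂ e₁ ↦
    h u₀ hu₀ u₁ hu₁ hd₀ hd₁ e₁ e₂⟩

lemma HasIsolatedCommonZero.of_neg (h : HasIsolatedCommonZero (-T₁) D₁ a₁ (-T₂) D₂ a₂) :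
    HasIsolatedCommonZero T₁ D₁ a₁ T₂ D₂ a₂ := by
  obtain ⟨y₀, h0, y₁, h1, hE₁, hE₂, ε, hε, h⟩ := h
  have key : ∀ {T D a u₀ u₁ : ℝ}, defect T D a u₀ u₁ = 0 → defect (-T) D a (-u₁) (-u₀) = 0 :=
    fun {T D a u₀ u₁} h ↦ by rw [defect_neg, h, neg_zero]
  refine ⟨-y₁, by linarith, -y₀, by linarith, by simpa using key hE₁, by simpa using key hE₂,
    ε, hε, fun u₀ hu₀ u₁ hu₁ hd₀ hd₁ e₁ e₂ ↦ ?_⟩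
  obtain ⟨h2, h3⟩ := h (-u₁) (by linarith) (-u₀) (by linarith)
    (by rw [← abs_neg]; convert hd₁ using 2; ring) (by rw [← abs_neg]; convert hd₀ using 2; ring)
    (key e₁) (key e₂)
  constructor <;> linarith

/-- A function that picks the end point of the arc from `(0, y₀)` is analytic. -/
lemma analyticAt_of_defect_eq_zero (hf : 0 < 4 * D - T ^ 2) (ha : a ≠ 0) {f : ℝ → ℝ}
    (hneg : ∀ y > 0, f y < 0) (hE : ∀ y > 0, defect T D a y (f y) = 0) {y : ℝ} (hy : 0 < y) :
    AnalyticAt ℝ f y := by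
  have hG := analyticAt_potential hf ha (f y)
  have hd : deriv (potential T D a) (f y) ≠ 0 := by
    rw [(hasDerivAt_potential hf ha (f y)).deriv]
    exact div_ne_zero (hneg y hy).ne (modulus_pos hf ha _).ne'
  have hinv := hG.analyticAt_localInverse hd
  have hright := HasStrictDerivAt.eventually_right_inverse hG.hasStrictDerivAt hd
  have himage : hG.hasStrictDerivAt.localInverse _ _ _ hd (potential T D a (f y)) = f y :=
    HasStrictFDerivAt.localInverse_apply_image ..
  set g := hG.hasStrictDerivAt.localInverse _ _ _ hd with hg
  set k := T / 2 / freq T D * turn a with hk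
  have hEy : ∀ u > 0, potential T D a (f u) = potential T D a u + k := fun u hu ↦ by
    have := hE u hu
    rw [defect] at this
    linarith
  have hneg' : ∀ᶠ e in 𝓝 (potential T D a (f y)), g e < 0 :=
    hinv.continuousAt.eventually (gt_mem_nhds (by rw [himage]; exact hneg y hy))
  have hshift : AnalyticAt ℝ (fun u ↦ potential T D a u + k) y :=
    (analyticAt_potential hf ha y).add analyticAt_const
  have hshift_y : potential T D a y + k = potential T D a (f y) := (hEy y hy).symm
  have hcomp : AnalyticAt ℝ (fun u ↦ g (potential T D a u + k)) y :=
    AnalyticAt.fun_comp (by rwa [hshift_y]) hshift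
  refine hcomp.congr ?_
  have ht : Tendsto (fun u ↦ potential T D a u + k) (𝓝 y) (𝓝 (potential T D a (f y))) := by
    rw [← hshift_y]; exact hshift.continuousAt
  -- The local inverse stays negative near `y`, where the potential is injective, so it must pick
  -- the same point as `f`.
  filter_upwards [ht.eventually hright, ht.eventually hneg', lt_mem_nhds hy] with u h1 h2 h3
  exact (strictAntiOn_potential hf ha).injOn (mem_Iic.2 h2.le) (mem_Iic.2 (hneg u h3).le)
    (h1.trans (hEy u h3).symm)

/-- As `T₁ > 0`, the zero curve of the first defect is a graph `y₁ = f y₀` over all `y₀ > 0`. The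
intermediate value theorem gives a zero of the second defect along it, and the identity theorem
isolates it. -/
lemma hasIsolatedCommonZero_of_sign_change (hf₁ : 0 < 4 * D₁ - T₁ ^ 2)
    (hf₂ : 0 < 4 * D₂ - T₂ ^ 2) (ha₁ : a₁ ≠ 0) (ha₂ : a₂ ≠ 0) (hT₁ : 0 < T₁)
    (hneg : ∃ y₀ > 0, ∃ y₁ < 0, defect T₁ D₁ a₁ y₀ y₁ = 0 ∧ defect T₂ D₂ a₂ y₀ y₁ < 0)
    (hpos : ∃ y₀ > 0, ∃ y₁ < 0, defect T₁ D₁ a₁ y₀ y₁ = 0 ∧ 0 < defect T₂ D₂ a₂ y₀ y₁) :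
    HasIsolatedCommonZero T₁ D₁ a₁ T₂ D₂ a₂ := by
  have hex : ∀ y : ℝ, ∃ v : ℝ, 0 < y → v < 0 ∧ defect T₁ D₁ a₁ y v = 0 := fun y ↦ by
    by_cases hy : 0 < y
    · obtain ⟨v, h1, h2⟩ := exists_defect_eq_zero hf₁ ha₁ hT₁ hy
      exact ⟨v, fun _ ↦ ⟨h1, h2⟩⟩
    · exact ⟨0, fun h ↦ absurd h hy⟩
  choose f hf using hex
  have hfa : ∀ y > 0, AnalyticAt ℝ f y := fun y hy ↦
    analyticAt_of_defect_eq_zero hf₁ ha₁ (fun u hu ↦ (hf u hu).1) (fun u hu ↦ (hf u hu).2) hy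
  have huniq : ∀ y > 0, ∀ v < 0, defect T₁ D₁ a₁ y v = 0 → v = f y := fun y hy v hv hE ↦
    defect_right_inj hf₁ ha₁ hv.le (hf y hy).1.le hE (hf y hy).2
  have hΔ : AnalyticOnNhd ℝ (fun y ↦ defect T₂ D₂ a₂ y (f y)) (Ioi 0) := fun y hy ↦
    ((AnalyticAt.fun_comp (analyticAt_potential hf₂ ha₂ (f y)) (hfa y hy)).sub
      (analyticAt_potential hf₂ ha₂ y)).sub analyticAt_const
  obtain ⟨p, hp, v, hv, hE, hp'⟩ := hneg
  rw [huniq p hp v hv hE] at hp'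
  obtain ⟨q, hq, w, hw, hE', hq'⟩ := hpos
  rw [huniq q hq w hw hE'] at hq'
  obtain ⟨z, hz, hz0⟩ := isPreconnected_Ioi.intermediate_value (mem_Ioi.2 hp) (mem_Ioi.2 hq)
    hΔ.continuousOn ⟨hp'.le, hq'.le⟩
  simp only at hz0
  -- Accumulating zeros would make the analytic function vanish on `(0, ∞)`, but it is positive at
  -- `q`.
  have hiso : ∀ᶠ u in 𝓝[≠] z, defect T₂ D₂ a₂ u (f u) ≠ 0 := by
    by_contra h
    have := hΔ.eqOn_zero_of_preconnected_of_frequently_eq_zero isPreconnected_Ioi hz h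
      (mem_Ioi.2 hq)
    exact hq'.ne' this
  obtain ⟨ε, hε, h⟩ := Metric.eventually_nhds_iff.1 (eventually_nhdsWithin_iff.1 hiso)
  refine ⟨z, hz, f z, (hf z hz).1, (hf z hz).2, hz0, ε, hε, fun u₀ hu₀ u₁ hu₁ hd _ e₁ e₂ ↦ ?_⟩
  have h1 := huniq u₀ hu₀ u₁ hu₁ e₁
  have h2 : u₀ = z := by
    by_contra hne
    exact h (by simpa [Real.dist_eq] using hd) hne (h1 ▸ e₂)
  exact ⟨h2, h2 ▸ h1⟩

/-- With `k = T / (2ω)` and `ω² = D - T²/4`, the difference `k₁² - k₂²` is a positive multiple of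
`T₁² D₂ - T₂² D₁`. -/
lemma damping_sub_mul_pos (hf₁ : 0 < 4 * D₁ - T₁ ^ 2) (hf₂ : 0 < 4 * D₂ - T₂ ^ 2)
    (hT₁ : 0 < T₁) (hT₂ : 0 < T₂) {s : ℝ} (hs : 0 < s * (T₁ * (T₁ ^ 2 * D₂ - T₂ ^ 2 * D₁))) :
    0 < s * (T₁ / 2 / freq T₁ D₁ - T₂ / 2 / freq T₂ D₂) := by
  have h1 := freq_pos hf₁
  have h2 := freq_pos hf₂
  have e : (T₁ / 2 / freq T₁ D₁ - T₂ / 2 / freq T₂ D₂) *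
      ((T₁ / 2 / freq T₁ D₁ + T₂ / 2 / freq T₂ D₂) * (4 * T₁ * freq T₁ D₁ ^ 2 * freq T₂ D₂ ^ 2)) =
      T₁ * (T₁ ^ 2 * D₂ - T₂ ^ 2 * D₁) := by
    have : (T₁ / 2 / freq T₁ D₁ - T₂ / 2 / freq T₂ D₂) *
      ((T₁ / 2 / freq T₁ D₁ + T₂ / 2 / freq T₂ D₂) * (4 * T₁ * freq T₁ D₁ ^ 2 * freq T₂ D₂ ^ 2)) =
      T₁ * (T₁ ^ 2 * freq T₂ D₂ ^ 2 - T₂ ^ 2 * freq T₁ D₁ ^ 2) := by field_simp; ring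
    rw [this, freq_sq hf₁, freq_sq hf₂]
    ring
  rw [← e, ← mul_assoc] at hs
  exact pos_of_mul_pos_left hs (by positivity)

/-- The second defect has the sign of `a₁ T₂ - a₂ T₁` at a far zero of the first one and the
opposite sign at a near one. -/
lemma hasIsolatedCommonZero_of_pos (hf₁ : 0 < 4 * D₁ - T₁ ^ 2)
    (hf₂ : 0 < 4 * D₂ - T₂ ^ 2) (ha₁ : a₁ ≠ 0) (ha₂ : 0 < a₂) (hT₁ : 0 < T₁) (hT₂ : 0 < T₂)
    (hξ : 0 < (a₁ * T₂ - a₂ * T₁) * (T₁ * (T₁ ^ 2 * D₂ - T₂ ^ 2 * D₁))) :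
    HasIsolatedCommonZero T₁ D₁ a₁ T₂ D₂ a₂ := by
  obtain ⟨u₀, hu₀, u₁, hu₁, hE, hu⟩ := exists_far_defect_pos hf₁ hf₂ ha₁ ha₂.ne' hT₁
    (damping_sub_mul_pos hf₁ hf₂ hT₁ hT₂ hξ)
  have hξ0 : a₁ * T₂ - a₂ * T₁ ≠ 0 := left_ne_zero_of_mul hξ.ne'
  obtain ⟨v₀, hv₀, v₁, hv₁, hE', hv⟩ : ∃ y₀ > 0, ∃ y₁ < 0, defect T₁ D₁ a₁ y₀ y₁ = 0 ∧
      (a₁ * T₂ - a₂ * T₁) * defect T₂ D₂ a₂ y₀ y₁ < 0 := by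
    rcases ha₁.lt_or_gt with h | h
    · obtain ⟨v₀, hv₀, v₁, hv₁, hE', hv⟩ := exists_near_defect_pos hf₁ hf₂ hT₁ h ha₂
      exact ⟨v₀, hv₀, v₁, hv₁, hE', mul_neg_of_neg_of_pos
        (by linarith [mul_neg_of_neg_of_pos h hT₂, mul_pos ha₂ hT₁]) hv⟩
    · exact exists_near_defect_neg hf₁ hf₂ h ha₂ hξ0
  rcases hξ0.lt_or_gt with h | h
  · exact hasIsolatedCommonZero_of_sign_change hf₁ hf₂ ha₁ ha₂.ne' hT₁
      ⟨u₀, hu₀, u₁, hu₁, hE, neg_of_mul_pos_right hu h.le⟩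
      ⟨v₀, hv₀, v₁, hv₁, hE', pos_of_mul_neg_right hv h.le⟩
  · exact hasIsolatedCommonZero_of_sign_change hf₁ hf₂ ha₁ ha₂.ne' hT₁
      ⟨v₀, hv₀, v₁, hv₁, hE', neg_of_mul_neg_right hv h.le⟩
      ⟨u₀, hu₀, u₁, hu₁, hE, pos_of_mul_pos_right hu h.le⟩

theorem hasIsolatedCommonZero (hf₁ : 0 < 4 * D₁ - T₁ ^ 2)
    (hf₂ : 0 < 4 * D₂ - T₂ ^ 2) (ha₁ : a₁ ≠ 0) (ha₂ : a₂ ≠ 0) (ha : 0 < a₁ ∨ 0 < a₂)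
    (hT : 0 < T₁ * T₂)
    (hξ : 0 < (a₁ * T₂ - a₂ * T₁) * (T₁ * (T₁ ^ 2 * D₂ - T₂ ^ 2 * D₁))) :
    HasIsolatedCommonZero T₁ D₁ a₁ T₂ D₂ a₂ := by
  wlog hT₁ : 0 < T₁ generalizing T₁ T₂
  · refine .of_neg (this (by simpa using hf₁) (by simpa using hf₂) (by simpa using hT) ?_ ?_)
    · exact hξ.trans_eq (by ring)
    · have : T₁ ≠ 0 := left_ne_zero_of_mul hT.ne'
      have := lt_of_le_of_ne (not_lt.1 hT₁) this
      linarith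
  have hT₂ : 0 < T₂ := pos_of_mul_pos_right hT hT₁.le
  rcases ha with h | h
  -- Exchanging the systems changes the sign of both antisymmetric factors in `hξ`, so their product
  -- is kept.
  · refine (hasIsolatedCommonZero_of_pos hf₂ hf₁ ha₂ h hT₂ hT₁ ?_).swap
    have : 0 < T₁ * ((a₂ * T₁ - a₁ * T₂) * (T₂ * (T₂ ^ 2 * D₁ - T₁ ^ 2 * D₂))) :=
      (mul_pos hT₂ hξ).trans_eq (by ring)
    exact pos_of_mul_pos_right this hT₁.le
  · exact hasIsolatedCommonZero_of_pos hf₁ hf₂ ha₁ h hT₁ hT₂ hξ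

end Analysis


/-! ### The flow of a focus -/

/-- The eigenvalue of the linear part with positive imaginary part. -/
noncomputable def eigenvalue (T D : ℝ) : ℂ := ⟨T / 2, freq T D⟩

/-- Complex coordinates centred at the focus in which the affine field is
`z ↦ eigenvalue T D * z`. -/
noncomputable def toComplex (T D a : ℝ) (p : ℝ × ℝ) : ℂ :=
  ⟨T / 2 * (p.1 - a / D) - (p.2 - T * (a / D)), freq T D * (p.1 - a / D)⟩

/-- The inverse of `toComplex`. -/
noncomputable def ofComplex (T D a : ℝ) (z : ℂ) : ℝ × ℝ :=
  (z.im / freq T D + a / D, T / 2 * (z.im / freq T D) - z.re + T * (a / D))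

/-- The flow of `field T D a` at time `t`. -/
noncomputable def flow (T D a t : ℝ) (p : ℝ × ℝ) : ℝ × ℝ :=
  ofComplex T D a (Complex.exp (eigenvalue T D * t) * toComplex T D a p)

/-! ### First return of a scalar function to zero. -/

section FirstReturn

variable {x : ℝ → ℝ} {d t₀ t : ℝ}

lemma eventually_neg_of_hasDerivAt_neg (hd : HasDerivAt x d t₀) (hneg : d < 0) (h0 : x t₀ = 0) :
    ∀ᶠ s in 𝓝[>] t₀, x s < 0 := by
  have := eventually_nhdsWithin_sign_eq_of_deriv_neg (by rwa [hd.deriv]) h0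
  filter_upwards [nhdsWithin_le_nhds this, self_mem_nhdsWithin] with s hs hs'
  rw [← sign_eq_neg_one_iff, hs, sign_eq_neg_one_iff]
  exact sub_neg.2 hs'

lemma eventually_pos_of_hasDerivAt_neg (hd : HasDerivAt x d t₀) (hneg : d < 0) (h0 : x t₀ = 0) :
    ∀ᶠ s in 𝓝[<] t₀, 0 < x s := by
  have := eventually_nhdsWithin_sign_eq_of_deriv_neg (by rwa [hd.deriv]) h0
  filter_upwards [nhdsWithin_le_nhds this, self_mem_nhdsWithin] with s hs hs'
  rw [← sign_eq_one_iff, hs, sign_eq_one_iff]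
  exact sub_pos.2 hs'

/-- A function that starts at zero with negative slope and is non-negative later has a first
return to zero. -/
lemma exists_first_return (hx : Continuous x) (hd : HasDerivAt x d t₀) (hneg : d < 0)
    (h0 : x t₀ = 0) (ht : t₀ < t) (hxt : 0 ≤ x t) :
    ∃ s ∈ Ioc t₀ t, x s = 0 ∧ ∀ r ∈ Ioo t₀ s, x r < 0 := by
  obtain ⟨u, hu, hneg'⟩ := mem_nhdsGT_iff_exists_Ioo_subset.1
    (eventually_neg_of_hasDerivAt_neg hd hneg h0)
  have hu' : t₀ < u := hu
  -- Starting the compact set at `m` excludes the trivial zero `t₀`.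
  obtain ⟨m, hm, hmu⟩ := exists_between (lt_min hu' ht)
  have hK : IsCompact (Icc m t ∩ x ⁻¹' Ici 0) :=
    isCompact_Icc.inter_right (isClosed_Ici.preimage hx)
  obtain ⟨s, ⟨hs, hxs⟩, hleast⟩ := hK.exists_isLeast
    ⟨t, ⟨(hmu.trans_le (min_le_right _ _)).le, le_rfl⟩, hxt⟩
  have hxm : x m < 0 := hneg' ⟨hm, hmu.trans_le (min_le_left _ _)⟩
  have hlt : ∀ r ∈ Ioo t₀ s, x r < 0 := fun r hr ↦ by
    by_contra! h
    rcases lt_or_ge r m with h1 | h1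
    · exact h.not_gt (hneg' ⟨hr.1, h1.trans (hmu.trans_le (min_le_left _ _))⟩)
    · exact hr.2.not_ge (hleast ⟨⟨h1, hr.2.le.trans hs.2⟩, h⟩)
  refine ⟨s, ⟨hm.trans_le hs.1, hs.2⟩, le_antisymm ?_ hxs, hlt⟩
  have hts : t₀ < s := hm.trans_le hs.1
  refine le_of_tendsto (hx.continuousWithinAt (s := Iio s) (x := s)).tendsto ?_
  filter_upwards [Ioo_mem_nhdsLT hts] with r hr using (hlt r hr).le

end FirstReturn

lemma hasDerivAt_fst {f : ℝ → ℝ × ℝ} {v : ℝ × ℝ} {t : ℝ} (h : HasDerivAt f v t) :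
    HasDerivAt (fun t ↦ (f t).1) v.1 t :=
  (hasFDerivAt_fst (𝕜 := ℝ) (p := f t)).comp_hasDerivAt t h

lemma hasDerivAt_snd {f : ℝ → ℝ × ℝ} {v : ℝ × ℝ} {t : ℝ} (h : HasDerivAt f v t) :
    HasDerivAt (fun t ↦ (f t).2) v.2 t :=
  (hasFDerivAt_snd (𝕜 := ℝ) (p := f t)).comp_hasDerivAt t h

/-! ### Explicit flow of a focus, in polar form. -/

section Flow

variable {T D a : ℝ}

lemma ofComplex_toComplex (hf : 0 < 4 * D - T ^ 2) (p : ℝ × ℝ) :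
    ofComplex T D a (toComplex T D a p) = p := by
  have := (freq_pos hf).ne'
  ext
  · simp only [ofComplex, toComplex]; field_simp; ring
  · simp only [ofComplex, toComplex]; field_simp; ring

lemma toComplex_ofComplex (hf : 0 < 4 * D - T ^ 2) (z : ℂ) :
    toComplex T D a (ofComplex T D a z) = z := by
  have := (freq_pos hf).ne'
  apply Complex.ext
  · simp only [ofComplex, toComplex]; ring
  · simp only [ofComplex, toComplex]; field_simp; ring

lemma toComplex_flow (hf : 0 < 4 * D - T ^ 2) (t : ℝ) (p : ℝ × ℝ) :
    toComplex T D a (flow T D a t p) =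
      Complex.exp (eigenvalue T D * t) * toComplex T D a p :=
  toComplex_ofComplex hf _

lemma flow_zero (hf : 0 < 4 * D - T ^ 2) (p : ℝ × ℝ) : flow T D a 0 p = p := by
  simp [flow, ofComplex_toComplex hf]

lemma hasDerivAt_flow (hf : 0 < 4 * D - T ^ 2) (t : ℝ) (p : ℝ × ℝ) :
    HasDerivAt (fun t ↦ flow T D a t p) (field T D a (flow T D a t p)) t := by
  have hw := (freq_pos hf).ne'
  have hz : HasDerivAt (fun t : ℝ ↦ Complex.exp (eigenvalue T D * t) * toComplex T D a p)
      (eigenvalue T D * toComplex T D a (flow T D a t p)) t := by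
    have h1 : HasDerivAt (fun t : ℂ ↦ Complex.exp (eigenvalue T D * t)) _ (t : ℂ) :=
      ((hasDerivAt_id (t : ℂ)).const_mul (eigenvalue T D)).cexp
    refine (h1.comp_ofReal.mul_const (toComplex T D a p)).congr_deriv ?_
    rw [toComplex_flow hf]
    simp only [id]
    ring
  have hre := Complex.reCLM.hasFDerivAt.comp_hasDerivAt t hz
  have him := Complex.imCLM.hasFDerivAt.comp_hasDerivAt t hz
  have h1 := (him.div_const (freq T D)).add_const (a / D)
  have h2 := (((him.div_const (freq T D)).const_mul (T / 2)).sub hre).add_const (T * (a / D))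
  refine HasDerivAt.congr_deriv (f := fun t ↦ flow T D a t p) (h1.prodMk h2) ?_
  generalize flow T D a t p = v
  have hD := (det_pos hf).ne'
  ext
  · simp only [Complex.imCLM_apply, eigenvalue, toComplex, Complex.mul_im, field]
    field_simp
    ring
  · simp only [Complex.imCLM_apply, Complex.reCLM_apply, eigenvalue, toComplex, Complex.mul_im,
      Complex.mul_re, field]
    have e : freq T D * (freq T D * (v.1 - a / D)) = (D - T ^ 2 / 4) * (v.1 - a / D) := by
      rw [← mul_assoc, ← sq, freq_sq hf]
    rw [e]
    field_simp
    ring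

lemma continuous_flow (hf : 0 < 4 * D - T ^ 2) (p : ℝ × ℝ) :
    Continuous (fun t ↦ flow T D a t p) :=
  continuous_iff_continuousAt.2 fun t ↦ (hasDerivAt_flow hf t p).continuousAt

lemma hasDerivAt_flow_fst (hf : 0 < 4 * D - T ^ 2) (t : ℝ) (p : ℝ × ℝ) :
    HasDerivAt (fun t ↦ (flow T D a t p).1)
      (T * (flow T D a t p).1 - (flow T D a t p).2) t :=
  hasDerivAt_fst (hasDerivAt_flow hf t p)

/-- Uniqueness of solutions of the affine system. -/
lemma eq_flow_of_hasDerivAt (hf : 0 < 4 * D - T ^ 2) {φ : ℝ → ℝ × ℝ} {t₀ t₁ : ℝ} (ht : t₀ < t₁)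
    (hc : ContinuousOn φ (Icc t₀ t₁))
    (hd : ∀ t ∈ Ioo t₀ t₁, HasDerivAt φ (field T D a (φ t)) t) :
    ∀ t ∈ Icc t₀ t₁, φ t = flow T D a (t - t₀) (φ t₀) := by
  -- Undoing the linear flow turns every solution into a constant.
  set w : ℝ → ℂ := fun t ↦ Complex.exp (-(eigenvalue T D * t)) * toComplex T D a (φ t) with hw
  have hwd : ∀ t ∈ Ioo t₀ t₁, HasDerivAt w 0 t := fun t ht ↦ by
    have hf1 := hasDerivAt_fst (hd t ht)
    have hf2 := hasDerivAt_snd (hd t ht)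
    have hre := ((hf1.sub_const (a / D)).const_mul (T / 2)).sub (hf2.sub_const (T * (a / D)))
    have him := (hf1.sub_const (a / D)).const_mul (freq T D)
    have hz : HasDerivAt (fun t ↦ toComplex T D a (φ t))
        (eigenvalue T D * toComplex T D a (φ t)) t := by
      have := (hre.ofReal_comp).add ((him.ofReal_comp).mul_const Complex.I)
      have e : ∀ s, toComplex T D a (φ s) = (((toComplex T D a (φ s)).re : ℝ) : ℂ) +
        (((toComplex T D a (φ s)).im : ℝ) : ℂ) * Complex.I := fun s ↦ (Complex.re_add_im _).symm
      rw [funext e]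
      refine this.congr_deriv ?_
      have hD := (det_pos hf).ne'
      have e2 : freq T D * (freq T D * ((φ t).1 - a / D)) =
          (D - T ^ 2 / 4) * ((φ t).1 - a / D) := by
        rw [← mul_assoc, ← sq, freq_sq hf]
      apply Complex.ext
      · simp [eigenvalue, toComplex, field, e2]
        field_simp
        ring
      · simp [eigenvalue, toComplex, field]
        ring
    have hexp : HasDerivAt (fun t : ℂ ↦ Complex.exp (-(eigenvalue T D * t))) _ (t : ℂ) :=
      ((hasDerivAt_id (t : ℂ)).const_mul (eigenvalue T D)).neg.cexp
    refine (hexp.comp_ofReal.mul hz).congr_deriv ?_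
    simp only [id, Pi.neg_apply]
    ring
  have hwc : ContinuousOn w (Icc t₀ t₁) := by
    have hz : Continuous (toComplex T D a) := by
      have : toComplex T D a = fun p ↦
        ((T / 2 * (p.1 - a / D) - (p.2 - T * (a / D)) : ℝ) : ℂ) +
          ((freq T D * (p.1 - a / D) : ℝ) : ℂ) * Complex.I :=
        funext fun p ↦ (Complex.re_add_im _).symm
      rw [this]
      fun_prop
    exact ContinuousOn.mul (by fun_prop) (hz.comp_continuousOn hc)
  obtain ⟨c, hcst⟩ := isOpen_Ioo.exists_is_const_of_deriv_eq_zero isPreconnected_Ioo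
    (fun t ht ↦ (hwd t ht).differentiableAt.differentiableWithinAt) (fun t ht ↦ (hwd t ht).deriv)
  have hcst' : EqOn w (fun _ ↦ c) (Icc t₀ t₁) :=
    Set.EqOn.of_subset_closure (s := Ioo t₀ t₁) (fun t ht ↦ hcst t ht) hwc continuousOn_const
      Ioo_subset_Icc_self (by rw [closure_Ioo ht.ne])
  intro t htt
  have h1 : w t = w t₀ := (hcst' htt).trans (hcst' (left_mem_Icc.2 ht.le)).symm
  rw [flow, ← ofComplex_toComplex (a := a) hf (φ t)]
  congr 1
  have h2 : toComplex T D a (φ t) = Complex.exp (eigenvalue T D * t) * w t := by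
    rw [hw]
    simp only
    rw [← mul_assoc, ← Complex.exp_add, add_neg_cancel, Complex.exp_zero, one_mul]
  rw [h2, h1, hw]
  simp only
  rw [← mul_assoc, ← Complex.exp_add]
  congr 2
  push_cast
  ring

/-- `angle T D a y` is the angle of `(0, y)` in complex coordinates centred at the focus, measured
from the direction of the equilibrium. -/
noncomputable def angle (T D a y : ℝ) : ℝ := Real.arctan (offset T D a y / height T D a)

lemma cos_angle_pos (y : ℝ) : 0 < Real.cos (angle T D a y) := Real.cos_arctan_pos _

lemma height_mul_sin_angle (hf : 0 < 4 * D - T ^ 2) (ha : a ≠ 0) (y : ℝ) :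
    height T D a * Real.sin (angle T D a y) = offset T D a y * Real.cos (angle T D a y) := by
  have h := height_ne_zero hf ha
  have hc := (cos_angle_pos (T := T) (D := D) (a := a) y).ne'
  have h1 : Real.tan (angle T D a y) = offset T D a y / height T D a := Real.tan_arctan _
  rw [Real.tan_eq_sin_div_cos] at h1
  field_simp at h1
  linarith

lemma modulus_mul_cos_sq (hf : 0 < 4 * D - T ^ 2) (ha : a ≠ 0) (y : ℝ) :
    (offset T D a y ^ 2 + height T D a ^ 2) * Real.cos (angle T D a y) ^ 2 = height T D a ^ 2 := by
  have h := height_mul_sin_angle hf ha y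
  have h2 := Real.sin_sq_add_cos_sq (angle T D a y)
  linear_combination (- height T D a * Real.sin (angle T D a y) -
    offset T D a y * Real.cos (angle T D a y)) * h + height T D a ^ 2 * h2

lemma toComplex_mk_zero (y : ℝ) :
    toComplex T D a (0, y) = ⟨offset T D a y, -height T D a⟩ := by
  simp only [toComplex, offset, height]
  apply Complex.ext <;> simp only <;> ring

/-- The radius, relative to the one of the equilibrium direction, of the orbit of `(0, y)`. -/
noncomputable def radius (T D a y t : ℝ) : ℝ :=
  Real.exp (T / 2 * t) / Real.cos (angle T D a y)

lemma toComplex_flow_mk_zero (hf : 0 < 4 * D - T ^ 2) (ha : a ≠ 0) (y t : ℝ) :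
    toComplex T D a (flow T D a t (0, y)) =
      ⟨height T D a * radius T D a y t * Real.sin (angle T D a y + freq T D * t),
        -(height T D a * radius T D a y t * Real.cos (angle T D a y + freq T D * t))⟩ := by
  have h := height_mul_sin_angle hf ha y
  have hc := (cos_angle_pos (T := T) (D := D) (a := a) y).ne'
  have hq : offset T D a y =
      height T D a * Real.sin (angle T D a y) / Real.cos (angle T D a y) := by
    field_simp; linarith
  rw [toComplex_flow hf, toComplex_mk_zero, Real.sin_add, Real.cos_add, radius, hq]
  have e1 : (eigenvalue T D * t).re = T / 2 * t := by simp [eigenvalue]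
  have e2 : (eigenvalue T D * t).im = freq T D * t := by simp [eigenvalue]
  apply Complex.ext
  · simp only [Complex.mul_re, Complex.exp_re, Complex.exp_im, e1, e2]
    field_simp
    ring
  · simp only [Complex.mul_im, Complex.exp_re, Complex.exp_im, e1, e2]
    field_simp
    ring

lemma flow_fst_eq (hf : 0 < 4 * D - T ^ 2) (ha : a ≠ 0) (y t : ℝ) :
    (flow T D a t (0, y)).1 =
      a / D * (1 - radius T D a y t * Real.cos (angle T D a y + freq T D * t)) := by
  have h := congrArg Complex.im (toComplex_flow_mk_zero hf ha y t)
  simp only [toComplex, height] at h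
  have hw := (freq_pos hf).ne'
  apply mul_left_cancel₀ hw
  linarith

lemma flow_eq_mk_zero_iff (hf : 0 < 4 * D - T ^ 2) (ha : a ≠ 0) (y v t : ℝ) :
    flow T D a t (0, y) = (0, v) ↔
      radius T D a y t * Real.cos (angle T D a y + freq T D * t) = 1 ∧
      height T D a * radius T D a y t * Real.sin (angle T D a y + freq T D * t) =
        offset T D a v := by
  have h := toComplex_flow_mk_zero hf ha y t
  have hh := height_ne_zero hf ha
  constructor
  · intro e
    rw [e, toComplex_mk_zero] at h
    have h1 := congrArg Complex.re h
    have h2 := congrArg Complex.im h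
    simp only at h1 h2
    refine ⟨mul_left_cancel₀ hh ?_, h1.symm⟩
    linarith
  · rintro ⟨h1, h2⟩
    rw [← ofComplex_toComplex (a := a) hf (flow T D a t (0, y)), h,
      ← ofComplex_toComplex (a := a) hf (0, v), toComplex_mk_zero, h2]
    congr 2
    rw [mul_assoc, h1, mul_one]

/-- The orbit of `(0, y₀)` enters `x < 0` and returns to the switching line at `(0, y₁)`
after time `τ`. -/
def IsArc (T D a y₀ y₁ τ : ℝ) : Prop :=
  0 < τ ∧ flow T D a τ (0, y₀) = (0, y₁) ∧ ∀ t ∈ Ioo 0 τ, (flow T D a t (0, y₀)).1 < 0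

lemma IsArc.unique {y₀ y₁ y₁' τ τ' : ℝ} (h : IsArc T D a y₀ y₁ τ) (h' : IsArc T D a y₀ y₁' τ') :
    τ = τ' := by
  rcases lt_trichotomy τ τ' with hlt | heq | hlt
  · have := h'.2.2 τ ⟨h.1, hlt⟩
    rw [h.2.1] at this
    exact absurd this (lt_irrefl _)
  · exact heq
  · have := h.2.2 τ' ⟨h'.1, hlt⟩
    rw [h'.2.1] at this
    exact absurd this (lt_irrefl _)

lemma tan_eq_of_radius (hf : 0 < 4 * D - T ^ 2) (ha : a ≠ 0) {v r θ : ℝ}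
    (h1 : r * Real.cos θ = 1) (h2 : height T D a * r * Real.sin θ = offset T D a v) :
    Real.arctan (Real.tan θ) = angle T D a v := by
  have hh := height_ne_zero hf ha
  have hc : Real.cos θ ≠ 0 := right_ne_zero_of_mul (h1 ▸ one_ne_zero)
  rw [angle, Real.tan_eq_sin_div_cos]
  congr 1
  rw [← h2]
  have hr : r = 1 / Real.cos θ := by field_simp; exact h1
  rw [hr]
  field_simp

lemma log_modulus_of_radius (hf : 0 < 4 * D - T ^ 2) (ha : a ≠ 0) {y v t : ℝ}
    (h : flow T D a t (0, y) = (0, v)) :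
    Real.log (offset T D a v ^ 2 + height T D a ^ 2) =
      Real.log (offset T D a y ^ 2 + height T D a ^ 2) + T * t := by
  obtain ⟨h1, h2⟩ := (flow_eq_mk_zero_iff hf ha y v t).1 h
  have hm := modulus_mul_cos_sq hf ha y
  have hc := (cos_angle_pos (T := T) (D := D) (a := a) y).ne'
  have e : offset T D a v ^ 2 + height T D a ^ 2 =
      (offset T D a y ^ 2 + height T D a ^ 2) * Real.exp (T * t) := by
    have e1 : offset T D a v ^ 2 + height T D a ^ 2 = height T D a ^ 2 * radius T D a y t ^ 2 := by
      have := Real.sin_sq_add_cos_sq (angle T D a y + freq T D * t)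
      rw [← h2]
      linear_combination height T D a ^ 2 * radius T D a y t ^ 2 * this - height T D a ^ 2 *
        (radius T D a y t * Real.cos (angle T D a y + freq T D * t) + 1) * h1
    have e2 : Real.exp (T * t) = Real.exp (T / 2 * t) ^ 2 := by
      rw [← Real.exp_nat_mul]; congr 1; push_cast; ring
    rw [e1, radius, e2, div_pow, ← mul_div_assoc, div_eq_iff (pow_ne_zero 2 hc)]
    linear_combination (-Real.exp (T / 2 * t) ^ 2) * hm
  rw [e, Real.log_mul (modulus_pos hf ha y).ne' (Real.exp_ne_zero _), Real.log_exp]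

lemma defect_eq_zero_of_angle (hf : 0 < 4 * D - T ^ 2) (ha : a ≠ 0) {y v t : ℝ}
    (h : flow T D a t (0, y) = (0, v))
    (hθ : angle T D a y + freq T D * t = angle T D a v + turn a) : defect T D a y v = 0 := by
  have hw := (freq_pos hf).ne'
  have hl := log_modulus_of_radius hf ha h
  rw [defect, potential, potential, hl]
  have : turn a = angle T D a y + freq T D * t - angle T D a v := by linarith
  rw [this, angle, angle]
  field_simp
  ring

end Flow


/-! ### Orbit arcs as zeros of the defect. -/

section Arc

variable {T D a : ℝ}

lemma angle_mem (y : ℝ) : angle T D a y ∈ Ioo (-(Real.pi / 2)) (Real.pi / 2) :=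
  Real.arctan_mem_Ioo _

lemma potential_eq_of_angle (hf : 0 < 4 * D - T ^ 2) (ha : a ≠ 0) {y v t : ℝ}
    (h : flow T D a t (0, y) = (0, v))
    (hθ : angle T D a y + freq T D * t = angle T D a v) :
    potential T D a v = potential T D a y := by
  have hw := (freq_pos hf).ne'
  have hl := log_modulus_of_radius hf ha h
  have e : angle T D a v = angle T D a y + freq T D * t := hθ.symm
  rw [angle, angle] at e
  rw [potential, potential, hl, e]
  field_simp
  ring

/-- An angle with positive cosine differs from an angle in `(-π / 2, π / 2)` by a multiple
of `2 π`. -/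
lemma exists_int_of_cos_pos {θ : ℝ} (h : 0 < Real.cos θ) :
    ∃ k : ℤ, θ = Real.arctan (Real.tan θ) + k * (2 * Real.pi) := by
  have hpi := Real.pi_pos
  set k := round (θ / (2 * Real.pi)) with hk
  have h1 := abs_sub_round (θ / (2 * Real.pi))
  rw [← hk, abs_le] at h1
  set ψ := θ - k * (2 * Real.pi) with hψ
  have e : θ / (2 * Real.pi) - k = ψ / (2 * Real.pi) := by rw [hψ]; field_simp
  rw [e, le_div_iff₀ (by positivity), div_le_iff₀ (by positivity)] at h1
  have hc : Real.cos ψ = Real.cos θ := by rw [hψ, Real.cos_sub_int_mul_two_pi]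
  have ht : Real.tan θ = Real.tan ψ := by
    have : (k : ℝ) * (2 * Real.pi) = ((2 * k : ℤ) : ℝ) * Real.pi := by push_cast; ring
    rw [hψ, this, Real.tan_sub_int_mul_pi]
  have hlt : ψ < Real.pi / 2 := by
    by_contra! h2
    have := Real.cos_nonpos_of_pi_div_two_le_of_le h2 (by linarith)
    linarith
  have hgt : -(Real.pi / 2) < ψ := by
    by_contra! h2
    have := Real.cos_nonpos_of_pi_div_two_le_of_le (x := -ψ) (by linarith) (by linarith)
    rw [Real.cos_neg] at this
    linarith
  refine ⟨k, ?_⟩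
  rw [ht, Real.arctan_tan hgt hlt, hψ]
  ring

lemma radius_pos (y t : ℝ) : 0 < radius T D a y t :=
  div_pos (Real.exp_pos _) (cos_angle_pos y)

/-- The end points of an orbit arc annihilate the defect. -/
lemma IsArc.defect_eq_zero (hf : 0 < 4 * D - T ^ 2) (ha : a ≠ 0) {y₀ y₁ τ : ℝ}
    (h : IsArc T D a y₀ y₁ τ) (hy : 0 < y₀) : defect T D a y₀ y₁ = 0 := by
  obtain ⟨hτ, hflow, hneg⟩ := h
  have hw := freq_pos hf
  have hD := det_pos hf
  have hpi := Real.pi_pos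
  obtain ⟨h1, h2⟩ := (flow_eq_mk_zero_iff hf ha y₀ y₁ τ).1 hflow
  set φ₀ := angle T D a y₀ with hφ₀
  have hφ₀m : φ₀ ∈ Ioo (-(Real.pi / 2)) (Real.pi / 2) := angle_mem y₀
  have hφ₁m : angle T D a y₁ ∈ Ioo (-(Real.pi / 2)) (Real.pi / 2) := angle_mem y₁
  have htan := tan_eq_of_radius hf ha h1 h2
  have hcos : 0 < Real.cos (φ₀ + freq T D * τ) :=
    pos_of_mul_pos_right (h1 ▸ one_pos) (radius_pos y₀ τ).le
  have hadv : 0 < freq T D * τ := mul_pos hw hτ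
  have hx : ∀ t ∈ Ioo 0 τ, a * (1 - radius T D a y₀ t * Real.cos (φ₀ + freq T D * t)) < 0 :=
    fun t ht ↦ by
      have := hneg t ht
      rw [flow_fst_eq hf ha, div_mul_eq_mul_div, div_neg_iff] at this
      rcases this with h | h
      · exact absurd h.2 hD.not_gt
      · exact h.1
  refine defect_eq_zero_of_angle hf ha hflow ?_
  by_cases hpos : 0 < a
  -- At angle `π/2` the abscissa is `a / D > 0`, so an arc in `x < 0` must return before reaching it
  -- and does not wind.
  · have hlt : φ₀ + freq T D * τ < Real.pi / 2 := by
      by_contra! hge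
      set t := (Real.pi / 2 - φ₀) / freq T D with ht
      have htw : φ₀ + freq T D * t = Real.pi / 2 := by rw [ht]; field_simp; ring
      have ht0 : 0 < t := div_pos (by linarith [hφ₀m.2]) hw
      have htτ : t ≤ τ := le_of_mul_le_mul_left (by linarith) hw
      rcases htτ.lt_or_eq with h' | h'
      · have := hx t ⟨ht0, h'⟩
        rw [htw, Real.cos_pi_div_two, mul_zero, sub_zero, mul_one] at this
        linarith
      · rw [← h', htw, Real.cos_pi_div_two] at hcos
        exact lt_irrefl _ hcos
    rw [Real.arctan_tan (by linarith [hφ₀m.1]) hlt] at htan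
    rw [htan, turn, if_pos hpos, add_zero]
  · have haneg : a < 0 := lt_of_le_of_ne (not_lt.1 hpos) ha
    have hlt1 : ∀ t ∈ Ioo 0 τ, radius T D a y₀ t * Real.cos (φ₀ + freq T D * t) < 1 :=
      fun t ht ↦ by
        by_contra! hge
        have := mul_nonneg_of_nonpos_of_nonpos haneg.le (sub_nonpos.2 hge)
        linarith [hx t ht]
    obtain ⟨k, hk⟩ := exists_int_of_cos_pos hcos
    rw [htan] at hk
    have hk0 : 0 ≤ k := by
      by_contra! hk'
      have : (k : ℝ) ≤ -1 := by exact_mod_cast Int.le_sub_one_of_lt hk'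
      nlinarith [hφ₀m.1, hφ₁m.2]
    -- Without winding the two ends have equal potential. As the height is negative, a growing angle
    -- means `y₀ < y₁`, which contradicts monotonicity on `y > 0`.
    have hk1 : k ≠ 0 := by
      rintro rfl
      simp only [Int.cast_zero, zero_mul, add_zero] at hk
      have hp := potential_eq_of_angle hf ha hflow hk
      have hlt : angle T D a y₀ < angle T D a y₁ := by rw [← hk]; linarith
      have hh := height_neg hf ha hpos
      have hq := (div_lt_div_right_of_neg hh).1 (Real.arctan_strictMono.lt_iff_lt.1 hlt)
      have hy01 : y₀ < y₁ := by rw [offset, offset] at hq; linarith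
      have := strictMonoOn_potential hf ha (mem_Ici.2 hy.le) (mem_Ici.2 (hy.trans hy01).le) hy01
      linarith
    -- A second turn would leave the zone: with `T ≥ 0` the point one turn after the start, and with
    -- `T < 0` the point one turn before the end, has the same angle as that end and a radius at
    -- least as large, so its abscissa is not negative.
    have hk2 : k < 2 := by
      by_contra! hk'
      have hk2 : (2 : ℝ) ≤ k := by exact_mod_cast hk'
      have hkpi : 2 * (2 * Real.pi) ≤ k * (2 * Real.pi) := by gcongr
      rcases le_or_gt 0 T with hT | hT
      · set t := 2 * Real.pi / freq T D with ht
        have htw : freq T D * t = 2 * Real.pi := by rw [ht]; field_simp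
        have ht0 : 0 < t := by positivity
        have htτ : t < τ := lt_of_mul_lt_mul_left (by linarith [hφ₀m.2, hφ₁m.1]) hw.le
        have := hlt1 t ⟨ht0, htτ⟩
        rw [htw, Real.cos_add_two_pi, radius, div_mul_cancel₀ _ (cos_angle_pos y₀).ne'] at this
        exact this.not_ge (Real.one_le_exp (by positivity))
      · set t := τ - 2 * Real.pi / freq T D with ht
        have htw : freq T D * t = freq T D * τ - 2 * Real.pi := by rw [ht]; field_simp
        have ht0 : 0 < t := by
          refine pos_of_mul_pos_right (?_ : 0 < freq T D * t) hw.le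
          linarith [hφ₀m.2, hφ₁m.1]
        have htτ : t < τ := by rw [ht]; linarith [show 0 < 2 * Real.pi / freq T D by positivity]
        have h3 := hlt1 t ⟨ht0, htτ⟩
        rw [htw, ← add_sub_assoc, Real.cos_sub_two_pi] at h3
        rw [← h1] at h3
        have h4 := lt_of_mul_lt_mul_right h3 hcos.le
        rw [radius, radius, div_lt_div_iff_of_pos_right (cos_angle_pos y₀), Real.exp_lt_exp] at h4
        nlinarith
    have : k = 1 := by omega
    rw [hk, this, turn, if_neg hpos]
    push_cast
    ring

/-- Every zero of the defect with `y₀ > 0 > y₁` comes from an orbit arc. -/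
lemma exists_isArc (hf : 0 < 4 * D - T ^ 2) (ha : a ≠ 0) {y₀ y₁ : ℝ}
    (hy₀ : 0 < y₀) (hy₁ : y₁ < 0) (hE : defect T D a y₀ y₁ = 0) :
    ∃ τ, IsArc T D a y₀ y₁ τ := by
  have hw := freq_pos hf
  have hpi := Real.pi_pos
  set σ := (angle T D a y₁ - angle T D a y₀ + turn a) / freq T D with hσ
  have hφ₀m : angle T D a y₀ ∈ Ioo (-(Real.pi / 2)) (Real.pi / 2) := angle_mem y₀
  have hφ₁m : angle T D a y₁ ∈ Ioo (-(Real.pi / 2)) (Real.pi / 2) := angle_mem y₁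
  have hσw : freq T D * σ = angle T D a y₁ - angle T D a y₀ + turn a := by
    rw [hσ]; field_simp
  have hσ0 : 0 < σ := by
    refine div_pos ?_ hw
    by_cases hpos : 0 < a
    · rw [turn, if_pos hpos, add_zero, sub_pos, angle, angle, Real.arctan_strictMono.lt_iff_lt,
        div_lt_div_iff_of_pos_right ((height_pos_iff hf).2 hpos), offset, offset]
      linarith
    · rw [turn, if_neg hpos]
      linarith [hφ₀m.2, hφ₁m.1]
  have hM₀ := modulus_pos hf ha y₀
  have hM₁ := modulus_pos hf ha y₁
  have hlog : Real.log (offset T D a y₁ ^ 2 + height T D a ^ 2) =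
      Real.log (offset T D a y₀ ^ 2 + height T D a ^ 2) + T * σ := by
    rw [defect, potential, potential] at hE
    have e : T * σ = 2 * (T / 2 / freq T D * (angle T D a y₁ - angle T D a y₀ + turn a)) := by
      rw [← hσw]; field_simp
    rw [e, angle, angle]
    linarith
  have hmod : offset T D a y₁ ^ 2 + height T D a ^ 2 =
      (offset T D a y₀ ^ 2 + height T D a ^ 2) * Real.exp (T / 2 * σ) ^ 2 := by
    rw [← Real.exp_log hM₁, hlog, Real.exp_add, Real.exp_log hM₀, ← Real.exp_nat_mul]
    congr 2
    push_cast
    ring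
  have hc₀ := cos_angle_pos (T := T) (D := D) (a := a) y₀
  have hc₁ := cos_angle_pos (T := T) (D := D) (a := a) y₁
  have hcoseq : Real.cos (angle T D a y₀ + freq T D * σ) = Real.cos (angle T D a y₁) := by
    have : angle T D a y₀ + freq T D * σ = angle T D a y₁ + turn a := by rw [hσw]; ring
    rw [this, turn]
    split_ifs <;> simp
  have hsineq : Real.sin (angle T D a y₀ + freq T D * σ) = Real.sin (angle T D a y₁) := by
    have : angle T D a y₀ + freq T D * σ = angle T D a y₁ + turn a := by rw [hσw]; ring
    rw [this, turn]
    split_ifs <;> simp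
  have hrad : radius T D a y₀ σ * Real.cos (angle T D a y₁) = 1 := by
    have h0 := modulus_mul_cos_sq hf ha y₀
    have h1 := modulus_mul_cos_sq hf ha y₁
    rw [hmod] at h1
    have h2 : (Real.exp (T / 2 * σ) * Real.cos (angle T D a y₁)) ^ 2 =
        Real.cos (angle T D a y₀) ^ 2 := by
      apply mul_left_cancel₀ hM₀.ne'
      linear_combination h1 - h0
    have h3 := (pow_left_inj₀ (by positivity) hc₀.le two_ne_zero).1 h2
    rw [radius, div_mul_eq_mul_div, h3, div_self hc₀.ne']
  have hflow : flow T D a σ (0, y₀) = (0, y₁) := by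
    refine (flow_eq_mk_zero_iff hf ha y₀ y₁ σ).2 ⟨by rw [hcoseq, hrad], ?_⟩
    have := height_mul_sin_angle hf ha y₁
    rw [hsineq]
    calc height T D a * radius T D a y₀ σ * Real.sin (angle T D a y₁)
        = radius T D a y₀ σ * (height T D a * Real.sin (angle T D a y₁)) := by ring
      _ = offset T D a y₁ * (radius T D a y₀ σ * Real.cos (angle T D a y₁)) := by rw [this]; ring
      _ = offset T D a y₁ := by rw [hrad, mul_one]
  have hxd := fun t ↦ hasDerivAt_flow_fst (a := a) hf t (0, y₀)
  have hxc : Continuous fun t ↦ (flow T D a t (0, y₀)).1 := (continuous_flow hf _).fst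
  -- The orbit is at `(0, y₁)` at time `σ`, possibly not for the first time. The first return also
  -- annihilates the defect, so injectivity identifies its end with `y₁`.
  obtain ⟨τ, hτ, hxτ, hneg⟩ := exists_first_return hxc (hxd 0)
    (by simpa [flow_zero hf] using hy₀) (by simp [flow_zero hf]) hσ0 (by rw [hflow])
  have hend : flow T D a τ (0, y₀) = (0, (flow T D a τ (0, y₀)).2) := Prod.ext hxτ rfl
  have hle : (flow T D a τ (0, y₀)).2 ≤ 0 := by
    by_contra! h
    have hd := hxd τ
    rw [hxτ, mul_zero, zero_sub] at hd
    obtain ⟨t, ht, ht'⟩ := ((eventually_pos_of_hasDerivAt_neg hd (by linarith) hxτ).and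
      (Ioo_mem_nhdsLT hτ.1)).exists
    exact ht.not_gt (hneg t ht')
  have harc : IsArc T D a y₀ _ τ := ⟨hτ.1, hend, hneg⟩
  have := defect_right_inj hf ha hle hy₁.le (harc.defect_eq_zero hf ha hy₀) hE
  rw [this] at harc
  exact ⟨τ, harc⟩

end Arc


/-! ### Regularity of Filippov solutions -/

/-- The difference of `f` and the integral of `g` is absolutely continuous with derivative zero
almost everywhere, hence constant. -/
lemma hasDerivAt_of_ae_hasDerivAt {F : Type*} [NormedAddCommGroup F] [NormedSpace ℝ F]
    [CompleteSpace F] {f g : ℝ → F} {a b t : ℝ} (hf : AbsolutelyContinuousOnInterval f a b)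
    (hg : Continuous g) (hd : ∀ᵐ s, s ∈ uIcc a b → HasDerivAt f (g s) s)
    (ht : t ∈ Ioo a b) : HasDerivAt f (g t) t := by
  have hG : ∀ s, HasDerivAt (fun s ↦ ∫ r in a..s, g r) (g s) s := fun s ↦
    (hg.integral_hasStrictDerivAt a s).hasDerivAt
  have hGac : AbsolutelyContinuousOnInterval (fun s ↦ ∫ r in a..s, g r) a b := by
    refine ContDiffOn.absolutelyContinuousOnInterval (ContDiff.contDiffOn ?_)
    refine contDiff_one_iff_deriv.2 ⟨fun s ↦ (hG s).differentiableAt, ?_⟩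
    rwa [funext fun s ↦ (hG s).deriv]
  obtain ⟨c, hc⟩ := (hf.sub hGac).const_of_ae_hasDerivAt_zero (by
    filter_upwards [hd] with s hs hs'
    simpa using (hs hs').sub (hG s))
  have hab : a ≤ b := (ht.1.trans ht.2).le
  have hev : f =ᶠ[𝓝 t] fun s ↦ (∫ r in a..s, g r) + c := by
    filter_upwards [Ioo_mem_nhds ht.1 ht.2] with s hs
    have := hc s (by rw [uIcc_of_le hab]; exact Ioo_subset_Icc_self hs)
    rw [← this]
    simp
  exact ((hG t).add_const c).congr_of_eventuallyEq hev

lemma absolutelyContinuousOnInterval_fst {f : ℝ → ℝ × ℝ} {a b : ℝ}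
    (hf : AbsolutelyContinuousOnInterval f a b) :
    AbsolutelyContinuousOnInterval (fun t ↦ (f t).1) a b := by
  rw [absolutelyContinuousOnInterval_iff] at hf ⊢
  intro ε hε
  obtain ⟨δ, hδ, h⟩ := hf ε hε
  refine ⟨δ, hδ, fun E hE hl ↦ lt_of_le_of_lt ?_ (h E hE hl)⟩
  exact Finset.sum_le_sum fun i _ ↦ le_max_left _ _

/-- A curve that follows the two linear systems classically off the switching line, and crosses the
line with the horizontal speed of both fields. -/
structure IsClassicalSolution (S : LienardPWL) (γ : ℝ → ℝ × ℝ) : Prop where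
  continuous : Continuous γ
  cross : ∀ t, (γ t).1 = 0 → HasDerivAt (fun t ↦ (γ t).1) (-(γ t).2) t
  left : ∀ t, (γ t).1 < 0 → HasDerivAt γ (S.leftField (γ t)) t
  right : ∀ t, 0 < (γ t).1 → HasDerivAt γ (S.rightField (γ t)) t

/-- On the switching line both fields have horizontal component `-y`, so the convex hull leaves only
the vertical component undetermined. Hence the abscissa of a Filippov solution is continuously
differentiable. -/
lemma filippov_fst {S : LienardPWL} {p v : ℝ × ℝ} (hv : v ∈ S.filippov p) :
    v.1 = S.TL * min p.1 0 + S.TR * max p.1 0 - p.2 := by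
  unfold filippov at hv
  split_ifs at hv with h1 h2
  · rw [mem_singleton_iff.1 hv, min_eq_left h1.le, max_eq_right h1.le]
    simp [leftField, field]
  · rw [mem_singleton_iff.1 hv, min_eq_right h2.le, max_eq_left h2.le]
    simp [rightField, field]
  · have h0 : p.1 = 0 := le_antisymm (not_lt.1 h2) (not_lt.1 h1)
    obtain ⟨a, b, -, -, hab, rfl⟩ := hv
    simp only [leftField, rightField, field, h0, Prod.fst_add, Prod.smul_fst, smul_eq_mul, min_self,
      max_self]
    linear_combination (-p.2) * hab

lemma IsSolution.isClassicalSolution {S : LienardPWL} {γ : ℝ → ℝ × ℝ} (h : S.IsSolution γ) :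
    S.IsClassicalSolution γ := by
  obtain ⟨hac, hae⟩ := h
  have hc : Continuous γ := continuous_iff_continuousAt.2 fun t ↦ by
    refine (hac (t - 1) (t + 1)).continuousOn.continuousAt ?_
    rw [uIcc_of_le (by linarith)]
    exact Icc_mem_nhds (by linarith) (by linarith)
  have hlf : Continuous S.leftField := by unfold leftField field; fun_prop
  have hrf : Continuous S.rightField := by unfold rightField field; fun_prop
  refine ⟨hc, fun t ht ↦ ?_, fun t ht ↦ ?_, fun t ht ↦ ?_⟩
  · have := hasDerivAt_of_ae_hasDerivAt (t := t)
      (absolutelyContinuousOnInterval_fst (hac (t - 1) (t + 1)))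
      (g := fun t ↦ S.TL * min (γ t).1 0 + S.TR * max (γ t).1 0 - (γ t).2) (by fun_prop)
      (by
        filter_upwards [hae] with s hs _
        obtain ⟨v, hv, hd⟩ := hs
        exact (hasDerivAt_fst hd).congr_deriv (filippov_fst hv))
      ⟨by linarith, by linarith⟩
    simpa [ht] using this
  · obtain ⟨δ, hδ, hneg⟩ := Metric.eventually_nhds_iff.1
      (hc.fst.continuousAt.eventually (gt_mem_nhds ht))
    refine hasDerivAt_of_ae_hasDerivAt (hac (t - δ / 2) (t + δ / 2)) (hlf.comp hc) ?_
      ⟨by linarith, by linarith⟩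
    filter_upwards [hae] with s hs hs'
    obtain ⟨v, hv, hd⟩ := hs
    rw [uIcc_of_le (by linarith)] at hs'
    have hx : (γ s).1 < 0 := hneg (by
      rw [Real.dist_eq, abs_lt]; constructor <;> linarith [hs'.1, hs'.2])
    rw [filippov, if_pos hx] at hv
    exact hd.congr_deriv hv
  · obtain ⟨δ, hδ, hpos⟩ := Metric.eventually_nhds_iff.1
      (hc.fst.continuousAt.eventually (lt_mem_nhds ht))
    refine hasDerivAt_of_ae_hasDerivAt (hac (t - δ / 2) (t + δ / 2)) (hrf.comp hc) ?_
      ⟨by linarith, by linarith⟩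
    filter_upwards [hae] with s hs hs'
    obtain ⟨v, hv, hd⟩ := hs
    rw [uIcc_of_le (by linarith)] at hs'
    have hx : 0 < (γ s).1 := hpos (by
      rw [Real.dist_eq, abs_lt]; constructor <;> linarith [hs'.1, hs'.2])
    rw [filippov, if_neg hx.not_gt, if_pos hx] at hv
    exact hd.congr_deriv hv

/-! ### Reflection -/

/-- The reflection of the plane in the switching line. -/
def reflectPoint (p : ℝ × ℝ) : ℝ × ℝ := (-p.1, p.2)

/-- The reflected curve, run backwards. -/
def reflectCurve (γ : ℝ → ℝ × ℝ) (t : ℝ) : ℝ × ℝ := reflectPoint (γ (-t))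

/-- The system solved by the reflected curves, run backwards. -/
def reflect (S : LienardPWL) : LienardPWL := ⟨-S.TR, S.DR, -S.aR, -S.TL, S.DL, -S.aL⟩

lemma reflectPoint_reflectPoint (p : ℝ × ℝ) : reflectPoint (reflectPoint p) = p := by
  simp [reflectPoint]

lemma reflectPoint_zero_mk (y : ℝ) : reflectPoint (0, y) = (0, y) := by simp [reflectPoint]

lemma hasDerivAt_reflectCurve {γ : ℝ → ℝ × ℝ} {v : ℝ × ℝ} {t : ℝ} (h : HasDerivAt γ v (-t)) :
    HasDerivAt (reflectCurve γ) (v.1, -v.2) t := by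
  have h1 : HasDerivAt (fun t ↦ γ (-t)) (-v) t := by
    simpa using! h.scomp t (hasDerivAt_neg t)
  have := (hasDerivAt_fst h1).neg.prodMk (hasDerivAt_snd h1)
  simpa using! this

lemma IsClassicalSolution.reflectCurve {S : LienardPWL} {γ : ℝ → ℝ × ℝ}
    (h : S.IsClassicalSolution γ) : S.reflect.IsClassicalSolution (reflectCurve γ) := by
  refine ⟨?_, fun t ht ↦ ?_, fun t ht ↦ ?_, fun t ht ↦ ?_⟩
  · have := h.continuous
    unfold LienardPWL.reflectCurve reflectPoint
    fun_prop
  · have h0 : (γ (-t)).1 = 0 := by simpa [LienardPWL.reflectCurve, reflectPoint] using ht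
    have h1 := ((h.cross (-t) h0).scomp t (hasDerivAt_neg t)).neg
    simpa [LienardPWL.reflectCurve, reflectPoint] using! h1
  · have h0 : 0 < (γ (-t)).1 := by simpa [LienardPWL.reflectCurve, reflectPoint] using ht
    refine (hasDerivAt_reflectCurve (h.right (-t) h0)).congr_deriv ?_
    simp only [rightField, leftField, field, reflect, LienardPWL.reflectCurve, reflectPoint]
    ext <;> simp only <;> ring
  · have h0 : (γ (-t)).1 < 0 := by simpa [LienardPWL.reflectCurve, reflectPoint] using ht
    refine (hasDerivAt_reflectCurve (h.left (-t) h0)).congr_deriv ?_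
    simp only [rightField, leftField, field, reflect, LienardPWL.reflectCurve, reflectPoint]
    ext <;> simp only <;> ring

/-! ### Passages through the half-planes -/

section Passages

variable {S : LienardPWL} {γ : ℝ → ℝ × ℝ}

lemma IsClassicalSolution.exists_next_left (h : S.IsClassicalSolution γ)
    (hf : 0 < 4 * S.DL - S.TL ^ 2) {t t' y : ℝ} (ht : γ t = (0, y)) (hy : 0 < y) (htt' : t < t')
    (ht' : 0 ≤ (γ t').1) :
    ∃ τ, ∃ y₁ ≤ 0, IsArc S.TL S.DL S.aL y y₁ τ ∧ γ (t + τ) = (0, y₁) ∧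
      ∀ s ∈ Icc 0 τ, γ (t + s) = flow S.TL S.DL S.aL s (0, y) := by
  have hxt : (γ t).1 = 0 := by rw [ht]
  obtain ⟨u, hu, hxu, hneg⟩ := exists_first_return h.continuous.fst (h.cross t hxt)
    (by rw [ht]; simpa using hy) hxt htt' ht'
  have hflow := eq_flow_of_hasDerivAt hf hu.1 h.continuous.continuousOn
    fun s hs ↦ h.left s (hneg s hs)
  have hflow' : ∀ s ∈ Icc 0 (u - t), γ (t + s) = flow S.TL S.DL S.aL s (0, y) := fun s hs ↦ by
    have := hflow (t + s) ⟨by linarith [hs.1], by linarith [hs.2]⟩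
    rwa [add_sub_cancel_left, ht] at this
  have hut : 0 < u - t := sub_pos.2 hu.1
  have hend : γ (t + (u - t)) = (0, (γ u).2) := by
    rw [add_sub_cancel]; exact Prod.ext hxu rfl
  refine ⟨u - t, (γ u).2, ?_, ⟨hut, ?_, fun s hs ↦ ?_⟩, hend, hflow'⟩
  · by_contra! hpos
    obtain ⟨r, hr, hr'⟩ := ((eventually_pos_of_hasDerivAt_neg (h.cross u hxu) (by linarith) hxu).and
      (Ioo_mem_nhdsLT hu.1)).exists
    exact hr.not_gt (hneg r hr')
  · rw [← hflow' _ ⟨hut.le, le_rfl⟩, hend]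
  · rw [← hflow' s (Ioo_subset_Icc_self hs)]
    exact hneg _ ⟨by linarith [hs.1], by linarith [hs.2]⟩

/-- A passage through `x > 0` traversed backwards is a forward passage of the reflected system
through `x < 0`. -/
lemma IsClassicalSolution.exists_prev_right (h : S.IsClassicalSolution γ)
    (hf : 0 < 4 * S.DR - S.TR ^ 2) {t t' y : ℝ} (ht : γ t = (0, y)) (hy : 0 < y) (htt' : t' < t)
    (ht' : (γ t').1 ≤ 0) :
    ∃ τ, ∃ y₁ ≤ 0, IsArc (-S.TR) S.DR (-S.aR) y y₁ τ ∧ γ (t - τ) = (0, y₁) ∧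
      ∀ s ∈ Icc 0 τ, γ (t - s) = reflectPoint (flow (-S.TR) S.DR (-S.aR) s (0, y)) := by
  have key : ∀ s, γ (t - s) = reflectPoint (LienardPWL.reflectCurve γ (-t + s)) := fun s ↦ by
    rw [LienardPWL.reflectCurve, reflectPoint_reflectPoint]
    congr 1
    ring
  obtain ⟨τ, y₁, hy₁, harc, hend, hflow⟩ := h.reflectCurve.exists_next_left (t := -t) (t' := -t')
    (y := y) (by simpa [reflect] using hf)
    (by simp [LienardPWL.reflectCurve, ht, reflectPoint]) hy (by linarith)
    (by simpa [LienardPWL.reflectCurve, reflectPoint] using ht')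
  refine ⟨τ, y₁, hy₁, harc, ?_, fun s hs ↦ ?_⟩
  · rw [key, hend, reflectPoint_zero_mk]
  · rw [key, hflow s hs]; rfl

/-- Arcs of the right zone are parametrized against time, so the passage is read backwards from its
end. Avoiding the origin makes that end have `y > 0`. -/
lemma IsClassicalSolution.exists_next_right (h : S.IsClassicalSolution γ)
    (hf : 0 < 4 * S.DR - S.TR ^ 2) (h0 : ∀ s, γ s ≠ 0) {t t' y : ℝ} (ht : γ t = (0, y))
    (hy : y < 0) (htt' : t < t') (ht' : (γ t').1 ≤ 0) :
    ∃ τ, ∃ y₀ > 0, IsArc (-S.TR) S.DR (-S.aR) y₀ y τ ∧ γ (t + τ) = (0, y₀) ∧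
      ∀ s ∈ Icc 0 τ, γ (t + τ - s) = reflectPoint (flow (-S.TR) S.DR (-S.aR) s (0, y₀)) := by
  have hxt : (γ t).1 = 0 := by rw [ht]
  obtain ⟨u, hu, hxu, hneg⟩ := exists_first_return (x := fun s ↦ -(γ s).1) h.continuous.fst.neg
    (h.cross t hxt).neg (by rw [ht]; simpa using hy) (by simp [hxt]) htt' (by simpa using ht')
  have hpos : ∀ r ∈ Ioo t u, 0 < (γ r).1 := fun r hr ↦ by simpa using hneg r hr
  have hxu' : (γ u).1 = 0 := by simpa using hxu
  have hyu : 0 < (γ u).2 := by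
    by_contra! hle
    have hlt : (γ u).2 < 0 := lt_of_le_of_ne hle fun h2 ↦ h0 u (Prod.ext hxu' h2)
    obtain ⟨r, hr, hr'⟩ := ((eventually_pos_of_hasDerivAt_neg (h.cross u hxu').neg
      (by linarith) (by simp [hxu'])).and (Ioo_mem_nhdsLT hu.1)).exists
    have := hpos r hr'
    simp only [Pi.neg_apply] at hr
    linarith
  obtain ⟨τ, y₁, hy₁, harc, hend, hflow⟩ := h.exists_prev_right hf (t := u) (t' := t)
    (Prod.ext hxu' rfl) hyu hu.1 hxt.le
  have hτ : τ = u - t := by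
    rcases lt_trichotomy τ (u - t) with hlt | heq | hlt
    · have := hpos (u - τ) ⟨by linarith, by linarith [harc.1]⟩
      rw [hend] at this
      exact absurd this (lt_irrefl _)
    · exact heq
    · have h1 := hflow (u - t) ⟨by linarith [hu.1], hlt.le⟩
      have h2 := harc.2.2 (u - t) ⟨by linarith [hu.1], hlt⟩
      rw [sub_sub_cancel, ht] at h1
      have h3 := congrArg Prod.fst h1
      simp only [reflectPoint] at h3
      linarith
  rw [hτ, sub_sub_cancel, ht] at hend
  obtain rfl : y = y₁ := congrArg Prod.snd hend
  refine ⟨τ, _, hyu, harc, ?_, fun s hs ↦ ?_⟩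
  · rw [hτ, add_sub_cancel]; exact Prod.ext hxu' rfl
  · rw [← hflow s hs, hτ, add_sub_cancel]

lemma IsClassicalSolution.exists_prev_left (h : S.IsClassicalSolution γ)
    (hf : 0 < 4 * S.DL - S.TL ^ 2) (h0 : ∀ s, γ s ≠ 0) {t t' y : ℝ} (ht : γ t = (0, y))
    (hy : y < 0) (htt' : t' < t) (ht' : 0 ≤ (γ t').1) :
    ∃ τ, ∃ y₀ > 0, IsArc S.TL S.DL S.aL y₀ y τ ∧ γ (t - τ) = (0, y₀) := by
  obtain ⟨τ, y₀, hy₀, harc, hend, -⟩ := h.reflectCurve.exists_next_right (t := -t) (t' := -t')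
    (y := y) (by simpa [reflect] using hf)
    (fun s hs ↦ h0 (-s) (by simpa [LienardPWL.reflectCurve, reflectPoint, Prod.ext_iff] using hs))
    (by simp [LienardPWL.reflectCurve, ht, reflectPoint]) hy (by linarith)
    (by simpa [LienardPWL.reflectCurve, reflectPoint] using ht')
  refine ⟨τ, y₀, hy₀, by simpa [reflect] using harc, ?_⟩
  have : γ (t - τ) = reflectPoint (LienardPWL.reflectCurve γ (-t + τ)) := by
    rw [LienardPWL.reflectCurve, reflectPoint_reflectPoint]
    congr 1
    ring
  rw [this, hend, reflectPoint_zero_mk]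

/-- A damped focus has no closed orbit within its zone. -/
lemma IsClassicalSolution.eq_of_periodic_of_neg (h : S.IsClassicalSolution γ)
    (hf : 0 < 4 * S.DL - S.TL ^ 2) (hT : S.TL ≠ 0) {P : ℝ} (hP : 0 < P)
    (hper : Function.Periodic γ P) (hneg : ∀ t, (γ t).1 < 0) (s t : ℝ) : γ s = γ t := by
  have hflow : ∀ t > 0, γ t = flow S.TL S.DL S.aL t (γ 0) := fun t ht ↦ by
    simpa using eq_flow_of_hasDerivAt hf ht h.continuous.continuousOn
      (fun s _ ↦ h.left s (hneg s)) t ⟨ht.le, le_rfl⟩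
  have h1 := congrArg (toComplex S.TL S.DL S.aL) (hflow P hP)
  rw [toComplex_flow hf, hper.eq] at h1
  -- One period multiplies the modulus by `exp (TL * P / 2) ≠ 1`.
  have h2 : toComplex S.TL S.DL S.aL (γ 0) = 0 := by
    by_contra hne
    have h3 := congrArg norm h1
    rw [norm_mul, Complex.norm_exp] at h3
    have h4 : Real.exp (eigenvalue S.TL S.DL * P).re = 1 :=
      mul_right_cancel₀ (norm_ne_zero_iff.2 hne) (by rw [one_mul]; exact h3.symm)
    rw [Real.exp_eq_one_iff] at h4
    simp only [eigenvalue, Complex.re_mul_ofReal] at h4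
    have : S.TL / 2 * P ≠ 0 := by positivity
    exact this h4
  have hconst : ∀ t, γ t = ofComplex S.TL S.DL S.aL 0 := fun t ↦ by
    obtain ⟨n, hn⟩ := exists_nat_gt (-t / P)
    rw [div_lt_iff₀ hP] at hn
    have := hflow (t + n * P) (by linarith)
    rw [flow, h2, mul_zero, hper.nat_mul n t] at this
    exact this
  rw [hconst s, hconst t]

lemma IsClassicalSolution.exists_fst_eq_zero (h : S.IsClassicalSolution γ)
    (hfL : 0 < 4 * S.DL - S.TL ^ 2) (hfR : 0 < 4 * S.DR - S.TR ^ 2) (hTL : S.TL ≠ 0)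
    (hTR : S.TR ≠ 0) {P : ℝ} (hP : 0 < P) (hper : Function.Periodic γ P)
    (hne : ∃ s t, γ s ≠ γ t) : ∃ t, (γ t).1 = 0 := by
  by_contra! hx
  obtain ⟨s, t, hst⟩ := hne
  have hivt : ∀ u v, (γ u).1 < 0 → ¬ 0 < (γ v).1 := fun u v hu hv ↦ by
    obtain ⟨w, hw⟩ := mem_range_of_exists_le_of_exists_ge h.continuous.fst ⟨u, hu.le⟩ ⟨v, hv.le⟩
    exact hx w hw
  rcases (hx 0).lt_or_gt with h0 | h0
  · exact hst (h.eq_of_periodic_of_neg hfL hTL hP hper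
      (fun t ↦ lt_of_le_of_ne (not_lt.1 (hivt 0 t h0)) (hx t)) s t)
  · have hper' : Function.Periodic (LienardPWL.reflectCurve γ) P := fun r ↦ by
      rw [LienardPWL.reflectCurve, LienardPWL.reflectCurve, neg_add, ← sub_eq_add_neg, hper.sub_eq]
    have := h.reflectCurve.eq_of_periodic_of_neg (by simpa [reflect] using hfR)
      (by simpa [reflect] using hTR) hP hper' (fun t ↦ by
        have : 0 < (γ (-t)).1 := lt_of_le_of_ne (not_lt.1 fun h' ↦ hivt _ _ h' h0) (hx _).symm
        simpa [LienardPWL.reflectCurve, reflectPoint] using this) (-s) (-t)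
    simp only [LienardPWL.reflectCurve, neg_neg] at this
    exact hst (by simpa [reflectPoint_reflectPoint] using congrArg reflectPoint this)

end Passages


/-! ### Closed orbits and common zeros of the two defects. -/

section ClosedOrbits

variable {S : LienardPWL} {γ : ℝ → ℝ × ℝ}

/-- A closed orbit that avoids the origin contains a common zero of the two defects. -/
lemma IsClassicalSolution.exists_common_zero (h : S.IsClassicalSolution γ)
    (hfL : 0 < 4 * S.DL - S.TL ^ 2) (hfR : 0 < 4 * S.DR - S.TR ^ 2) (haL : S.aL ≠ 0)
    (haR : S.aR ≠ 0) (hTL : S.TL ≠ 0) (hTR : S.TR ≠ 0) {P : ℝ} (hP : 0 < P)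
    (hper : Function.Periodic γ P) (hne : ∃ s t, γ s ≠ γ t) (h0 : ∀ s, γ s ≠ 0) :
    ∃ t u, ∃ y₀ > 0, ∃ y₁ < 0, γ t = (0, y₀) ∧ γ u = (0, y₁) ∧
      defect S.TL S.DL S.aL y₀ y₁ = 0 ∧ defect (-S.TR) S.DR (-S.aR) y₀ y₁ = 0 := by
  have hfR' : 0 < 4 * S.DR - (-S.TR) ^ 2 := by simpa using hfR
  have haR' : -S.aR ≠ 0 := neg_ne_zero.2 haR
  have hneg : ∀ {t y : ℝ}, γ t = (0, y) → y ≤ 0 → y < 0 := fun {t y} ht hy ↦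
    lt_of_le_of_ne hy fun h1 ↦ h0 t (by rw [ht, h1]; rfl)
  obtain ⟨t, ht⟩ := h.exists_fst_eq_zero hfL hfR hTL hTR hP hper hne
  have hA : ∃ t, (γ t).1 = 0 ∧ 0 ≤ (γ t).2 := by
    by_cases hy : 0 ≤ (γ t).2
    · exact ⟨t, ht, hy⟩
    · obtain ⟨τ, y₀, hy₀, -, hend, -⟩ := h.exists_next_right hfR h0 (t := t) (t' := t + P)
        (Prod.ext ht rfl) (not_le.1 hy) (by linarith) (by rw [hper t, ht])
      exact ⟨t + τ, by rw [hend], by rw [hend]; exact le_of_lt hy₀⟩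
  have hK : IsCompact (Icc 0 P ∩ {t | (γ t).1 = 0 ∧ 0 ≤ (γ t).2}) :=
    isCompact_Icc.inter_right ((isClosed_eq h.continuous.fst continuous_const).inter
      (isClosed_le continuous_const h.continuous.snd))
  have hred : ∀ t, ∃ s ∈ Icc 0 P, γ t = γ s := fun t ↦ by
    obtain ⟨s, hs, hs'⟩ := hper.exists_mem_Ico₀ hP t
    exact ⟨s, Ico_subset_Icc_self hs, hs'⟩
  -- The highest intersection with `x = 0` is a fixed point of the return map: its image and its
  -- preimage lie no higher, and the half-maps are monotone.
  obtain ⟨m, ⟨hmP, hm1, hm2⟩, hmax⟩ := hK.exists_isMaxOn (by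
    obtain ⟨t, h1, h2⟩ := hA
    obtain ⟨s, hs, hs'⟩ := hred t
    rw [hs'] at h1 h2
    exact ⟨s, hs, h1, h2⟩) h.continuous.snd.continuousOn
  have hmax' : ∀ {t y : ℝ}, γ t = (0, y) → 0 < y → y ≤ (γ m).2 := fun {t y} ht hy ↦ by
    obtain ⟨s, hs, hs'⟩ := hred t
    rw [hs'] at ht
    have := hmax ⟨hs, by rw [ht], by rw [ht]; exact hy.le⟩
    simpa [ht] using this
  set M := (γ m).2 with hM
  have hγm : γ m = (0, M) := Prod.ext hm1 rfl
  have hMpos : 0 < M := lt_of_le_of_ne hm2 fun h1 ↦ h0 m (by rw [hγm, ← h1]; rfl)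
  obtain ⟨τ, b, hb, harc, hend, -⟩ := h.exists_next_left hfL hγm hMpos (t' := m + P)
    (by linarith) (by rw [hper m, hm1])
  have hb' := hneg hend hb
  obtain ⟨τ', v, hv, harc', hend', -⟩ := h.exists_next_right hfR h0 hend hb' (t' := m + τ + P)
    (by linarith) (by rw [hper, hend])
  obtain ⟨σ, c, hc, hArc, hEnd, -⟩ := h.exists_prev_right hfR hγm hMpos (t' := m - P)
    (by linarith) (by rw [hper.sub_eq, hm1])
  have hc' := hneg hEnd hc
  obtain ⟨σ', w, hw, hArc', hEnd'⟩ := h.exists_prev_left hfL h0 hEnd hc' (t' := m - σ - P)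
    (by linarith) (by rw [hper.sub_eq, hEnd])
  have e1 := harc.defect_eq_zero hfL haL hMpos
  have e2 := harc'.defect_eq_zero hfR' haR' hv
  have e3 := hArc.defect_eq_zero hfR' haR' hMpos
  have e4 := hArc'.defect_eq_zero hfL haL hw
  have hmono₂ := (strictMonoOn_potential hfR' haR').monotoneOn (mem_Ici.2 (le_of_lt hv))
    (mem_Ici.2 hMpos.le) (hmax' hend' hv)
  have hmono₁ := (strictMonoOn_potential hfL haL).monotoneOn (mem_Ici.2 (le_of_lt hw))
    (mem_Ici.2 hMpos.le) (hmax' hEnd' hw)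
  unfold defect at e1 e2 e3 e4
  -- The right arcs from the heights `v ≤ M` end at `b` and `c`, and the left arcs from `w ≤ M` end
  -- at `c` and `b`; the two comparisons give opposite inequalities.
  have hbc : c ≤ b := ((strictAntiOn_potential hfR' haR').le_iff_ge (mem_Iic.2 hb)
    (mem_Iic.2 hc)).1 (by linarith)
  have hcb : b ≤ c := ((strictAntiOn_potential hfL haL).le_iff_ge (mem_Iic.2 hc)
    (mem_Iic.2 hb)).1 (by linarith)
  obtain rfl := le_antisymm hbc hcb
  exact ⟨m, m + τ, M, hMpos, c, hc', hγm, hend, e1, e3⟩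

/-- The closed curve made of the orbit arc of the left system that starts at `(0, y)` and of the one
of the right system that ends there, of durations `τ₁` and `τ₂`. -/
noncomputable def loop (S : LienardPWL) (y τ₁ τ₂ s : ℝ) : ℝ × ℝ :=
  if s ≤ τ₁ then flow S.TL S.DL S.aL s (0, y)
  else reflectPoint (flow (-S.TR) S.DR (-S.aR) (τ₁ + τ₂ - s) (0, y))

/-- The periodic extension of `loop`. -/
noncomputable def periodicLoop (S : LienardPWL) (y τ₁ τ₂ t : ℝ) : ℝ × ℝ :=
  S.loop y τ₁ τ₂ ((τ₁ + τ₂) * Int.fract (t / (τ₁ + τ₂)))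

variable {y₀ y₁ τ₁ τ₂ : ℝ}

lemma loop_of_le {s : ℝ} (hs : s ≤ τ₁) :
    S.loop y₀ τ₁ τ₂ s = flow S.TL S.DL S.aL s (0, y₀) := if_pos hs

lemma loop_of_ge (h₁ : IsArc S.TL S.DL S.aL y₀ y₁ τ₁)
    (h₂ : IsArc (-S.TR) S.DR (-S.aR) y₀ y₁ τ₂) {s : ℝ} (hs : τ₁ ≤ s) :
    S.loop y₀ τ₁ τ₂ s = reflectPoint (flow (-S.TR) S.DR (-S.aR) (τ₁ + τ₂ - s) (0, y₀)) := by
  rcases hs.eq_or_lt with rfl | hs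
  · rw [loop_of_le le_rfl, h₁.2.1, add_sub_cancel_left, h₂.2.1, reflectPoint_zero_mk]
  · exact if_neg hs.not_ge

/-- Uniqueness in each zone forces the solution along the two arcs. Injectivity of the right
half-map makes the second arc end at `y₀` again. -/
lemma IsClassicalSolution.eq_loop (h : S.IsClassicalSolution γ)
    (hfL : 0 < 4 * S.DL - S.TL ^ 2) (hfR : 0 < 4 * S.DR - S.TR ^ 2)
    (haR : S.aR ≠ 0) {P : ℝ} (hP : 0 < P)
    (hper : Function.Periodic γ P) (h0 : ∀ s, γ s ≠ 0) (hy₀ : 0 < y₀)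
    (h₁ : IsArc S.TL S.DL S.aL y₀ y₁ τ₁) (h₂ : IsArc (-S.TR) S.DR (-S.aR) y₀ y₁ τ₂) {t : ℝ}
    (ht : γ t = (0, y₀)) : ∀ s ∈ Icc 0 (τ₁ + τ₂), γ (t + s) = S.loop y₀ τ₁ τ₂ s := by
  have hfR' : 0 < 4 * S.DR - (-S.TR) ^ 2 := by simpa using hfR
  have haR' : -S.aR ≠ 0 := neg_ne_zero.2 haR
  obtain ⟨τ, b, hb, harc, hend, hleft⟩ := h.exists_next_left hfL ht hy₀ (t' := t + P)
    (by linarith) (by rw [hper t, ht])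
  obtain rfl := harc.unique h₁
  obtain rfl : b = y₁ := congrArg Prod.snd (harc.2.1.symm.trans h₁.2.1)
  have hb' : b < 0 := lt_of_le_of_ne hb fun h1 ↦ h0 _ (by rw [hend, h1]; rfl)
  obtain ⟨τ', v, hv, harc', -, hright⟩ := h.exists_next_right hfR h0 hend hb' (t' := t + τ + P)
    (by linarith) (by rw [hper, hend])
  obtain rfl := defect_left_inj hfR' haR' (le_of_lt hv) hy₀.le
    (harc'.defect_eq_zero hfR' haR' hv) (h₂.defect_eq_zero hfR' haR' hy₀)
  obtain rfl := harc'.unique h₂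
  intro s hs
  rcases le_total s τ with hsτ | hsτ
  · rw [hleft s ⟨hs.1, hsτ⟩, loop_of_le hsτ]
  · rw [loop_of_ge h₁ h₂ hsτ, ← hright _ ⟨by linarith [hs.2], by linarith⟩]
    congr 1
    ring

lemma loop_end (hfR : 0 < 4 * S.DR - S.TR ^ 2) (h₁ : IsArc S.TL S.DL S.aL y₀ y₁ τ₁)
    (h₂ : IsArc (-S.TR) S.DR (-S.aR) y₀ y₁ τ₂) : S.loop y₀ τ₁ τ₂ (τ₁ + τ₂) = (0, y₀) := by
  rw [loop_of_ge h₁ h₂ (by linarith [h₂.1]), sub_self, flow_zero (by simpa using hfR),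
    reflectPoint_zero_mk]

lemma IsClassicalSolution.range_eq_loop (h : S.IsClassicalSolution γ)
    (hfL : 0 < 4 * S.DL - S.TL ^ 2) (hfR : 0 < 4 * S.DR - S.TR ^ 2)
    (haR : S.aR ≠ 0) {P : ℝ} (hP : 0 < P)
    (hper : Function.Periodic γ P) (h0 : ∀ s, γ s ≠ 0) (hy₀ : 0 < y₀)
    (h₁ : IsArc S.TL S.DL S.aL y₀ y₁ τ₁) (h₂ : IsArc (-S.TR) S.DR (-S.aR) y₀ y₁ τ₂) {t : ℝ}
    (ht : γ t = (0, y₀)) : range γ = S.loop y₀ τ₁ τ₂ '' Icc 0 (τ₁ + τ₂) := by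
  have hloop := fun {t : ℝ} (ht : γ t = (0, y₀)) ↦
    h.eq_loop hfL hfR haR hP hper h0 hy₀ h₁ h₂ ht
  have hpos : 0 < τ₁ + τ₂ := add_pos h₁.1 h₂.1
  have hn : ∀ n : ℕ, γ (t + n * (τ₁ + τ₂)) = (0, y₀) := fun n ↦ by
    induction n with
    | zero => simpa using ht
    | succ n ih =>
      have := hloop ih (τ₁ + τ₂) ⟨hpos.le, le_rfl⟩
      rw [loop_end hfR h₁ h₂] at this
      rw [← this]
      congr 1
      push_cast
      ring
  ext p
  constructor
  · rintro ⟨r, rfl⟩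
    -- Adding periods moves `r` beyond `t`; removing whole loops then leaves a parameter in `[0, τ₁
    -- + τ₂]`.
    obtain ⟨k, hk⟩ := exists_nat_gt ((t - r) / P)
    rw [div_lt_iff₀ hP] at hk
    set u := (r + k * P - t) / (τ₁ + τ₂) with hu
    have hu0 : 0 ≤ u := div_nonneg (by linarith) hpos.le
    have hur : u * (τ₁ + τ₂) = r + k * P - t := by rw [hu]; field_simp
    have h3 := Nat.floor_le hu0
    have h4 := (Nat.lt_floor_add_one u).le
    refine ⟨r + k * P - t - ⌊u⌋₊ * (τ₁ + τ₂), ⟨?_, ?_⟩, ?_⟩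
    · nlinarith
    · nlinarith
    · rw [← hloop (hn ⌊u⌋₊), ← hper.nat_mul k r]
      · congr 1
        ring
      · constructor <;> nlinarith
  · rintro ⟨s, hs, rfl⟩
    exact ⟨t + s, hloop ht s hs⟩

/-! ### The closed orbit through a common zero -/

lemma periodicLoop_add (h₁ : 0 < τ₁) (h₂ : 0 < τ₂) (n : ℤ) {s : ℝ} (hs : s ∈ Ico 0 (τ₁ + τ₂)) :
    S.periodicLoop y₀ τ₁ τ₂ (n * (τ₁ + τ₂) + s) = S.loop y₀ τ₁ τ₂ s := by
  have hpos : 0 < τ₁ + τ₂ := add_pos h₁ h₂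
  have e : (n * (τ₁ + τ₂) + s) / (τ₁ + τ₂) = n + s / (τ₁ + τ₂) := by field_simp
  rw [periodicLoop, e, Int.fract_intCast_add, Int.fract_eq_self.2
    ⟨div_nonneg hs.1 hpos.le, (div_lt_one hpos).2 hs.2⟩, mul_div_cancel₀ _ hpos.ne']

lemma exists_int_mul_add {P : ℝ} (hP : 0 < P) (t : ℝ) :
    ∃ n : ℤ, ∃ s ∈ Ico 0 P, t = n * P + s := by
  refine ⟨⌊t / P⌋, P * Int.fract (t / P), ⟨by have := Int.fract_nonneg (t / P); positivity, ?_⟩, ?_⟩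
  · exact mul_lt_of_lt_one_right hP (Int.fract_lt_one _)
  · rw [Int.fract]
    field_simp
    ring

lemma continuous_loop (hfL : 0 < 4 * S.DL - S.TL ^ 2) (hfR : 0 < 4 * S.DR - S.TR ^ 2)
    (h₁ : IsArc S.TL S.DL S.aL y₀ y₁ τ₁) (h₂ : IsArc (-S.TR) S.DR (-S.aR) y₀ y₁ τ₂) :
    Continuous (S.loop y₀ τ₁ τ₂) := by
  have hc1 := continuous_flow (a := S.aL) hfL (0, y₀)
  have hc2 := continuous_flow (T := -S.TR) (a := -S.aR) (D := S.DR) (by simpa using hfR) (0, y₀)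
  have hrefl : Continuous reflectPoint := by unfold reflectPoint; fun_prop
  refine Continuous.if_le hc1 (hrefl.comp (hc2.comp (by fun_prop))) continuous_id continuous_const ?_
  rintro s rfl
  rw [← loop_of_ge h₁ h₂ le_rfl, ← loop_of_le le_rfl]

lemma continuous_periodicLoop (hfL : 0 < 4 * S.DL - S.TL ^ 2) (hfR : 0 < 4 * S.DR - S.TR ^ 2)
    (h₁ : IsArc S.TL S.DL S.aL y₀ y₁ τ₁) (h₂ : IsArc (-S.TR) S.DR (-S.aR) y₀ y₁ τ₂) :
    Continuous (S.periodicLoop y₀ τ₁ τ₂) := by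
  have hc : Continuous fun x ↦ S.loop y₀ τ₁ τ₂ ((τ₁ + τ₂) * x) :=
    (continuous_loop hfL hfR h₁ h₂).comp (by fun_prop)
  have hfr := ContinuousOn.comp_fract'' hc.continuousOn (by
    simp only [mul_zero, mul_one]
    rw [loop_end hfR h₁ h₂, loop_of_le h₁.1.le, flow_zero hfL])
  exact hfr.comp (continuous_id.div_const _)

lemma periodic_periodicLoop (h₁ : 0 < τ₁) (h₂ : 0 < τ₂) :
    Function.Periodic (S.periodicLoop y₀ τ₁ τ₂) (τ₁ + τ₂) := fun t ↦ by
  have hpos : 0 < τ₁ + τ₂ := add_pos h₁ h₂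
  rw [periodicLoop, periodicLoop, add_div, div_self hpos.ne', Int.fract_add_one]

lemma hasDerivAt_reflectPoint_flow (hfR : 0 < 4 * S.DR - S.TR ^ 2) (c s : ℝ) (p : ℝ × ℝ) :
    HasDerivAt (fun s ↦ reflectPoint (flow (-S.TR) S.DR (-S.aR) (c - s) p))
      (S.rightField (reflectPoint (flow (-S.TR) S.DR (-S.aR) (c - s) p))) s := by
  have h1 : HasDerivAt (fun u ↦ flow (-S.TR) S.DR (-S.aR) (c + u) p) _ (-s) :=
    (hasDerivAt_flow (T := -S.TR) (by simpa using hfR) (c + -s) p).comp_const_add c (-s)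
  refine (hasDerivAt_reflectCurve h1).congr_deriv ?_
  simp only [rightField, field, reflectPoint, sub_eq_add_neg]
  ext <;> simp only <;> ring

lemma loop_fst_neg (h₁ : IsArc S.TL S.DL S.aL y₀ y₁ τ₁) {s : ℝ} (hs : s ∈ Ioo 0 τ₁) :
    (S.loop y₀ τ₁ τ₂ s).1 < 0 := by
  rw [loop_of_le hs.2.le]
  exact h₁.2.2 s hs

lemma loop_fst_pos (h₁ : IsArc S.TL S.DL S.aL y₀ y₁ τ₁)
    (h₂ : IsArc (-S.TR) S.DR (-S.aR) y₀ y₁ τ₂) {s : ℝ} (hs : s ∈ Ioo τ₁ (τ₁ + τ₂)) :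
    0 < (S.loop y₀ τ₁ τ₂ s).1 := by
  rw [loop_of_ge h₁ h₂ hs.1.le]
  have := h₂.2.2 (τ₁ + τ₂ - s) ⟨by linarith [hs.2], by linarith [hs.1]⟩
  simpa [reflectPoint] using this

lemma loop_cases (hfL : 0 < 4 * S.DL - S.TL ^ 2) (h₁ : IsArc S.TL S.DL S.aL y₀ y₁ τ₁)
    (h₂ : IsArc (-S.TR) S.DR (-S.aR) y₀ y₁ τ₂) {s : ℝ} (hs : s ∈ Ico 0 (τ₁ + τ₂)) :
    (S.loop y₀ τ₁ τ₂ s).1 ≠ 0 ∨ S.loop y₀ τ₁ τ₂ s = (0, y₀) ∨ S.loop y₀ τ₁ τ₂ s = (0, y₁) := by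
  rcases hs.1.eq_or_lt with rfl | h0
  · right; left; rw [loop_of_le h₁.1.le, flow_zero hfL]
  rcases lt_trichotomy s τ₁ with h | rfl | h
  · exact .inl (loop_fst_neg h₁ ⟨h0, h⟩).ne
  · right; right; rw [loop_of_le le_rfl, h₁.2.1]
  · exact .inl (loop_fst_pos h₁ h₂ ⟨h, hs.2⟩).ne'

lemma periodicLoop_cases (hfL : 0 < 4 * S.DL - S.TL ^ 2) (h₁ : IsArc S.TL S.DL S.aL y₀ y₁ τ₁)
    (h₂ : IsArc (-S.TR) S.DR (-S.aR) y₀ y₁ τ₂) (t : ℝ) :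
    (S.periodicLoop y₀ τ₁ τ₂ t).1 ≠ 0 ∨ S.periodicLoop y₀ τ₁ τ₂ t = (0, y₀) ∨
      S.periodicLoop y₀ τ₁ τ₂ t = (0, y₁) := by
  obtain ⟨n, s, hs, rfl⟩ := exists_int_mul_add (add_pos h₁.1 h₂.1) t
  rw [periodicLoop_add h₁.1 h₂.1 n hs]
  exact loop_cases hfL h₁ h₂ hs

lemma periodicLoop_eventuallyEq_left (h₁ : 0 < τ₁) (h₂ : 0 < τ₂) (n : ℤ) {t : ℝ} {l : Filter ℝ}
    (hl : ∀ᶠ r in l, r - n * (τ₁ + τ₂) ∈ Icc 0 τ₁) (ht : t = n * (τ₁ + τ₂)) :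
    S.periodicLoop y₀ τ₁ τ₂ =ᶠ[l] fun r ↦ flow S.TL S.DL S.aL (r - t) (0, y₀) := by
  filter_upwards [hl] with r hr
  have := periodicLoop_add (S := S) (y₀ := y₀) h₁ h₂ n (s := r - n * (τ₁ + τ₂))
    ⟨hr.1, by linarith [hr.2]⟩
  rw [add_sub_cancel, loop_of_le hr.2] at this
  rw [this, ht]

lemma periodicLoop_eventuallyEq_right (h₁ : IsArc S.TL S.DL S.aL y₀ y₁ τ₁)
    (h₂ : IsArc (-S.TR) S.DR (-S.aR) y₀ y₁ τ₂) (n : ℤ) {t : ℝ} {l : Filter ℝ}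
    (hl : ∀ᶠ r in l, r - n * (τ₁ + τ₂) ∈ Ico τ₁ (τ₁ + τ₂)) (ht : t = n * (τ₁ + τ₂)) :
    S.periodicLoop y₀ τ₁ τ₂ =ᶠ[l]
      fun r ↦ reflectPoint (flow (-S.TR) S.DR (-S.aR) (τ₁ + τ₂ + t - r) (0, y₀)) := by
  filter_upwards [hl] with r hr
  have := periodicLoop_add (S := S) (y₀ := y₀) h₁.1 h₂.1 n (s := r - n * (τ₁ + τ₂))
    ⟨h₁.1.le.trans hr.1, hr.2⟩
  rw [add_sub_cancel, loop_of_ge h₁ h₂ hr.1] at this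
  rw [this, ht]
  congr 2
  ring

lemma hasDerivAt_flow_sub (hfL : 0 < 4 * S.DL - S.TL ^ 2) (c t : ℝ) (p : ℝ × ℝ) :
    HasDerivAt (fun r ↦ flow S.TL S.DL S.aL (r - c) p)
      (S.leftField (flow S.TL S.DL S.aL (t - c) p)) t :=
  (hasDerivAt_flow hfL (t - c) p).comp_sub_const t c

lemma isSolution_periodicLoop (hfL : 0 < 4 * S.DL - S.TL ^ 2) (hfR : 0 < 4 * S.DR - S.TR ^ 2)
    (h₁ : IsArc S.TL S.DL S.aL y₀ y₁ τ₁) (h₂ : IsArc (-S.TR) S.DR (-S.aR) y₀ y₁ τ₂) :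
    S.IsSolution (S.periodicLoop y₀ τ₁ τ₂) := by
  have hpos : 0 < τ₁ + τ₂ := add_pos h₁.1 h₂.1
  have hcont := continuous_periodicLoop hfL hfR h₁ h₂
  constructor
  · have hlf : Continuous S.leftField := by unfold leftField field; fun_prop
    have hrf : Continuous S.rightField := by unfold rightField field; fun_prop
    obtain ⟨C, hC⟩ := isCompact_Icc.exists_bound_of_continuousOn (s := Icc 0 (τ₁ + τ₂))
      (f := fun s ↦ ‖S.leftField (S.periodicLoop y₀ τ₁ τ₂ s)‖ +
        ‖S.rightField (S.periodicLoop y₀ τ₁ τ₂ s)‖) (by fun_prop)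
    have hbound : ∀ t, ‖S.leftField (S.periodicLoop y₀ τ₁ τ₂ t)‖ +
        ‖S.rightField (S.periodicLoop y₀ τ₁ τ₂ t)‖ ≤ C := fun t ↦ by
      obtain ⟨s, hs, hst⟩ := (periodic_periodicLoop (S := S) (y₀ := y₀) h₁.1 h₂.1).exists_mem_Ico₀
        hpos t
      rw [hst]
      exact (le_abs_self _).trans (hC s (Ico_subset_Icc_self hs))
    -- Right derivatives exist also at the corners on the switching line. Their uniform bound makes
    -- the curve Lipschitz, hence absolutely continuous.
    have hder : ∀ t, ∃ v, ‖v‖ ≤ C ∧ HasDerivWithinAt (S.periodicLoop y₀ τ₁ τ₂) v (Ici t) t :=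
      fun t ↦ by
        have hb := hbound t
        have hn1 := norm_nonneg (S.leftField (S.periodicLoop y₀ τ₁ τ₂ t))
        have hn2 := norm_nonneg (S.rightField (S.periodicLoop y₀ τ₁ τ₂ t))
        obtain ⟨n, s, hs, hts⟩ := exists_int_mul_add hpos t
        rcases lt_or_ge s τ₁ with h | h
        · have hev := periodicLoop_eventuallyEq_left (S := S) (y₀ := y₀) h₁.1 h₂.1 n
            (l := 𝓝[≥] t) (by
              filter_upwards [Ico_mem_nhdsGE (show t < n * (τ₁ + τ₂) + τ₁ by linarith)] with r hr
              exact ⟨by linarith [hr.1, hs.1], by linarith [hr.2]⟩) rfl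
          have heq := hev.self_of_nhdsWithin (mem_Ici.2 le_rfl)
          refine ⟨S.leftField (S.periodicLoop y₀ τ₁ τ₂ t), by linarith, ?_⟩
          rw [heq]
          exact (hasDerivAt_flow_sub hfL _ t _).hasDerivWithinAt.congr_of_eventuallyEq hev heq
        · have hev := periodicLoop_eventuallyEq_right h₁ h₂ n
            (l := 𝓝[≥] t) (by
              filter_upwards [Ico_mem_nhdsGE
                (show t < n * (τ₁ + τ₂) + (τ₁ + τ₂) by linarith [hs.2])] with r hr
              exact ⟨by linarith [hr.1, hs.1], by linarith [hr.2]⟩) rfl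
          have heq := hev.self_of_nhdsWithin (mem_Ici.2 le_rfl)
          refine ⟨S.rightField (S.periodicLoop y₀ τ₁ τ₂ t), by linarith, ?_⟩
          rw [heq]
          exact (hasDerivAt_reflectPoint_flow hfR _ t _).hasDerivWithinAt.congr_of_eventuallyEq
            hev heq
    choose v hvC hv using hder
    have hlip : LipschitzWith C.toNNReal (S.periodicLoop y₀ τ₁ τ₂) := by
      have hC0 : 0 ≤ C := (norm_nonneg _).trans (hvC 0)
      have key : ∀ a b, a ≤ b → dist (S.periodicLoop y₀ τ₁ τ₂ b) (S.periodicLoop y₀ τ₁ τ₂ a) ≤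
          C * dist b a := fun a b hab ↦ by
        rw [dist_eq_norm, Real.dist_eq, abs_of_nonneg (sub_nonneg.2 hab)]
        exact norm_image_sub_le_of_norm_deriv_right_le_segment hcont.continuousOn
          (fun x _ ↦ hv x) (fun x _ ↦ hvC x) b ⟨hab, le_rfl⟩
      refine LipschitzWith.of_dist_le_mul fun a b ↦ ?_
      rw [Real.coe_toNNReal _ hC0]
      rcases le_total a b with hab | hab
      · rw [dist_comm, dist_comm a b]; exact key a b hab
      · exact key b a hab
    exact fun a b ↦ (hlip.lipschitzOnWith).absolutelyContinuousOnInterval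
  · have hcount : (range (fun n : ℤ ↦ (n : ℝ) * (τ₁ + τ₂)) ∪
        range (fun n : ℤ ↦ (n : ℝ) * (τ₁ + τ₂) + τ₁)).Countable :=
      (countable_range _).union (countable_range _)
    filter_upwards [hcount.ae_notMem volume] with t ht
    simp only [mem_union, mem_range, not_or, not_exists] at ht
    obtain ⟨n, s, hs, hts⟩ := exists_int_mul_add hpos t
    have hs0 : 0 < s := lt_of_le_of_ne hs.1 fun h ↦ ht.1 n (by rw [hts, ← h, add_zero])
    have hsτ : s ≠ τ₁ := fun h ↦ ht.2 n (by rw [hts, h])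
    have hval := periodicLoop_add (S := S) (y₀ := y₀) h₁.1 h₂.1 n hs
    rw [← hts] at hval
    rcases hsτ.lt_or_gt with h | h
    · have hev := periodicLoop_eventuallyEq_left (S := S) (y₀ := y₀) h₁.1 h₂.1 n
        (l := 𝓝 t) (by
          filter_upwards [Ioo_mem_nhds (show n * (τ₁ + τ₂) < t by linarith)
            (show t < n * (τ₁ + τ₂) + τ₁ by linarith)] with r hr
          exact ⟨by linarith [hr.1], by linarith [hr.2]⟩) rfl
      refine ⟨S.leftField (S.periodicLoop y₀ τ₁ τ₂ t), ?_, ?_⟩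
      · have hneg := loop_fst_neg (τ₂ := τ₂) h₁ ⟨hs0, h⟩
        rw [← hval] at hneg
        rw [filippov, if_pos hneg]
        rfl
      · rw [hev.self_of_nhds]
        exact (hasDerivAt_flow_sub hfL _ t _).congr_of_eventuallyEq hev
    · have hev := periodicLoop_eventuallyEq_right h₁ h₂ n
        (l := 𝓝 t) (by
          filter_upwards [Ioo_mem_nhds (show n * (τ₁ + τ₂) + τ₁ < t by linarith)
            (show t < n * (τ₁ + τ₂) + (τ₁ + τ₂) by linarith [hs.2])] with r hr
          exact ⟨by linarith [hr.1], by linarith [hr.2]⟩) rfl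
      refine ⟨S.rightField (S.periodicLoop y₀ τ₁ τ₂ t), ?_, ?_⟩
      · have hp := loop_fst_pos h₁ h₂ ⟨h, hs.2⟩
        rw [← hval] at hp
        rw [filippov, if_neg hp.not_gt, if_pos hp]
        rfl
      · rw [hev.self_of_nhds]
        exact (hasDerivAt_reflectPoint_flow hfR _ t _).congr_of_eventuallyEq hev

/-- An isolated common zero of the defects gives a limit cycle. -/
theorem exists_isLimitCycle (hfL : 0 < 4 * S.DL - S.TL ^ 2) (hfR : 0 < 4 * S.DR - S.TR ^ 2)
    (haL : S.aL ≠ 0) (haR : S.aR ≠ 0) (hTL : S.TL ≠ 0) (hTR : S.TR ≠ 0)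
    (h : HasIsolatedCommonZero S.TL S.DL S.aL (-S.TR) S.DR (-S.aR)) :
    ∃ Γ : Set (ℝ × ℝ), S.IsLimitCycle Γ := by
  obtain ⟨y₀, hy₀, y₁, hy₁, hE₁, hE₂, ε, hε, hiso⟩ := h
  obtain ⟨τ₁, h₁⟩ := exists_isArc hfL haL hy₀ hy₁ hE₁
  obtain ⟨τ₂, h₂⟩ := exists_isArc (by simpa using hfR) (neg_ne_zero.2 haR) hy₀ hy₁ hE₂
  have hsol := isSolution_periodicLoop hfL hfR h₁ h₂
  have hper := periodic_periodicLoop (S := S) (y₀ := y₀) h₁.1 h₂.1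
  have hpos : 0 < τ₁ + τ₂ := add_pos h₁.1 h₂.1
  have hcases := periodicLoop_cases hfL h₁ h₂
  have hat0 : S.periodicLoop y₀ τ₁ τ₂ 0 = (0, y₀) := by
    have := periodicLoop_add (S := S) (y₀ := y₀) h₁.1 h₂.1 0 (s := 0) ⟨le_rfl, hpos⟩
    rw [loop_of_le h₁.1.le, flow_zero hfL] at this
    simpa using this
  have hatτ : S.periodicLoop y₀ τ₁ τ₂ τ₁ = (0, y₁) := by
    have := periodicLoop_add (S := S) (y₀ := y₀) h₁.1 h₂.1 0 (s := τ₁)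
      ⟨h₁.1.le, by linarith [h₂.1]⟩
    rw [loop_of_le le_rfl, h₁.2.1] at this
    simpa using this
  have hzero : ∀ t, S.periodicLoop y₀ τ₁ τ₂ t ≠ 0 := fun t ht ↦ by
    rcases hcases t with h | h | h
    · exact h (by rw [ht]; rfl)
    · exact (ne_of_gt hy₀) (congrArg Prod.snd (h.symm.trans ht))
    · exact hy₁.ne (congrArg Prod.snd (h.symm.trans ht))
  have hrange := hsol.isClassicalSolution.range_eq_loop hfL hfR haR hpos hper hzero hy₀ h₁ h₂ hat0
  refine ⟨range (S.periodicLoop y₀ τ₁ τ₂), ⟨⟨_, τ₁ + τ₂, hsol, hpos, hper, ⟨0, τ₁, ?_⟩, rfl⟩,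
    ⟨(0, y₀), ⟨0, hat0⟩, rfl⟩, ?_⟩, ?_⟩
  · rw [hat0, hatτ]
    intro h
    exact (hy₁.trans hy₀).ne' (congrArg Prod.snd h)
  · rintro p ⟨⟨t, rfl⟩, hp⟩
    refine ⟨hp, ?_⟩
    have hp1 : (S.periodicLoop y₀ τ₁ τ₂ t).1 = 0 := hp
    have hp2 : (S.periodicLoop y₀ τ₁ τ₂ t).2 ≠ 0 := fun h ↦ hzero t (Prod.ext hp1 h)
    simp only [leftField, rightField, field, hp1, mul_zero, zero_sub]
    exact mul_self_pos.2 (neg_ne_zero.2 hp2)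
  -- With this `δ` the windows around `y₀` and `y₁` on the switching line miss the origin and keep
  -- to their own sides of it. A closed orbit in the neighbourhood then meets the line only near the
  -- known common zero.
  set δ := min ε (min y₀ (-y₁)) with hδ
  have hδ0 : 0 < δ := lt_min hε (lt_min hy₀ (by linarith))
  have hδε : δ ≤ ε := min_le_left _ _
  have hδ₀ : δ ≤ y₀ := (min_le_right _ _).trans (min_le_left _ _)
  have hδ₁ : δ ≤ -y₁ := (min_le_right _ _).trans (min_le_right _ _)
  refine ⟨{p | p.1 ≠ 0 ∨ |p.2 - y₀| < δ ∨ |p.2 - y₁| < δ}, ?_, ?_, ?_⟩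
  · have hopen : ∀ c : ℝ, IsOpen {p : ℝ × ℝ | |p.2 - c| < δ} := fun c ↦
      isOpen_lt (continuous_snd.sub continuous_const).abs continuous_const
    exact (isOpen_ne_fun continuous_fst continuous_const).union ((hopen y₀).union (hopen y₁))
  · rintro p ⟨t, rfl⟩
    rcases hcases t with h | h | h
    · exact .inl h
    · exact .inr (.inl (by simpa [h] using hδ0))
    · exact .inr (.inr (by simpa [h] using hδ0))
  · rintro Γ' ⟨γ, P, hγ, hP, hγper, hγne, rfl⟩ hU
    have hγU : ∀ t, (γ t).1 ≠ 0 ∨ |(γ t).2 - y₀| < δ ∨ |(γ t).2 - y₁| < δ := fun t ↦ hU ⟨t, rfl⟩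
    have hγ0 : ∀ t, γ t ≠ 0 := fun t ht ↦ by
      rcases hγU t with h | h | h
      · exact h (by rw [ht]; rfl)
      · rw [ht, abs_lt] at h
        simp only [Prod.snd_zero] at h
        linarith
      · rw [ht, abs_lt] at h
        simp only [Prod.snd_zero] at h
        linarith
    have hcl := hγ.isClassicalSolution
    obtain ⟨t, u, v₀, hv₀, v₁, hv₁, ht, hu, e₁, e₂⟩ :=
      hcl.exists_common_zero hfL hfR haL haR hTL hTR hP hγper hγne hγ0
    have hd₀ : |v₀ - y₀| < ε := by
      rcases hγU t with h | h | h
      · exact absurd (by rw [ht]) h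
      · rw [ht] at h; exact h.trans_le hδε
      · rw [ht, abs_lt] at h
        simp only at h
        linarith
    have hd₁ : |v₁ - y₁| < ε := by
      rcases hγU u with h | h | h
      · exact absurd (by rw [hu]) h
      · rw [hu, abs_lt] at h
        simp only at h
        linarith
      · rw [hu] at h; exact h.trans_le hδε
    obtain ⟨rfl, rfl⟩ := hiso v₀ hv₀ v₁ hv₁ hd₀ hd₁ e₁ e₂
    rw [hrange]
    exact hcl.range_eq_loop hfL hfR haR hP hγper hγ0 hv₀ h₁ h₂ ht

end ClosedOrbits

/-! ### Monodromic singularities -/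

lemma isFocusOrCenter {T D a : ℝ} (hf : 0 < 4 * D - T ^ 2) :
    IsFocusOrCenter T D a (a / D, T * (a / D)) := by
  have hD := (det_pos hf).ne'
  refine ⟨?_, eq_empty_iff_forall_notMem.2 fun μ hμ ↦ ?_⟩
  · ext
    · simp [field]
    · simp only [field, Prod.snd_zero]
      field_simp
      ring
  · rw [spectrum.mem_iff] at hμ
    refine hμ ((Matrix.isUnit_iff_isUnit_det _).2 (isUnit_iff_ne_zero.2 ?_))
    have : (algebraMap ℝ (Matrix (Fin 2) (Fin 2) ℝ) μ - linPart T D).det = (μ - T) * μ + D := by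
      rw [Matrix.det_fin_two, Matrix.algebraMap_eq_diagonal]
      simp [linPart]
    rw [this]
    nlinarith [sq_nonneg (2 * μ - T)]

end LienardPWL

theorem mainTheorem4 (S : LienardPWL)
    (hT : S.TL * S.TR < 0)
    (hc0 : S.c0 ≠ 0)
    (hyL : S.ForwardHalfMapExists)
    (hyR : S.BackwardHalfMapExists)
    (hmono : ∃! p : ℝ × ℝ, S.IsMonodromicSingularity p)
    (hL : 0 < 4 * S.DL - S.TL ^ 2)
    (hR : 0 < 4 * S.DR - S.TR ^ 2)
    (hξ : 0 < S.xi * S.cInf) :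
    ∃ Γ : Set (ℝ × ℝ), S.IsLimitCycle Γ := by
  have haRL : S.aR * S.aL ≠ 0 := left_ne_zero_of_mul hc0
  have haL : S.aL ≠ 0 := right_ne_zero_of_mul haRL
  have haR : S.aR ≠ 0 := left_ne_zero_of_mul haRL
  refine LienardPWL.exists_isLimitCycle hL hR haL haR (left_ne_zero_of_mul hT.ne)
    (right_ne_zero_of_mul hT.ne)
    (LienardPWL.hasIsolatedCommonZero hL (by simpa using hR) haL (neg_ne_zero.2 haR) ?_
      (by linarith) ?_)
  -- If `aL` and `-aR` were both negative, each zone would contain its own focus, giving two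
  -- monodromic singularities.
  · by_contra! h
    have hLneg : S.aL / S.DL < 0 :=
      div_neg_of_neg_of_pos (lt_of_le_of_ne h.1 haL) (LienardPWL.det_pos hL)
    have hRpos : 0 < S.aR / S.DR :=
      div_pos (lt_of_le_of_ne (by linarith [h.2]) haR.symm) (LienardPWL.det_pos hR)
    have heq := hmono.unique (.inl ⟨hLneg, LienardPWL.isFocusOrCenter hL⟩)
      (.inr (.inl ⟨hRpos, LienardPWL.isFocusOrCenter hR⟩))
    exact (hLneg.trans hRpos).ne (congrArg Prod.fst heq)
  · rw [LienardPWL.xi, LienardPWL.cInf] at hξ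
    exact hξ.trans_eq (by ring)
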